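/- **FKN theorem for the slice.** For integers $0\le k\le n$ let $\binom{[n]}{k}=\{x\in\{0,1\}^n:\sum_i x_i=k\}$ with the uniform distribution, and put $\|g\|^2=\mathbb{E}[g^2]$ for $g\colon\binom{[n]}{k}\to\mathbb{R}$. Two functions $g,h$ are called $\epsilon$-close if $\|g-h\|^2\le\epsilon$. An affine function is one of the form $x\mapsto c_0+\sum_{i=1}^n c_ix_i$ with real $c_0,\dots,c_n$. By convention $\max_{i\in\emptyset}x_i=0$ and $\min_{i\in\emptyset}x_i=1$. There exist absolute constants $C_1,C_2,c>0$ such that the following holds for all integers $n,k$ with $2\le k\le n-2$, all real $\epsilon$, and all $f\colon\binom{[n]}{k}\to\{0,1\}$ that are $\epsilon$-close to an affine function. Let $p=\min(k/n,1-k/n)$. 1. If $k\le n/2$, then there is a set $S\subseteq[n]$ with $|S|\le\max(1,C_2\sqrt{\epsilon}/p)$ such that $f$ or $1-f$ is $C_1\epsilon$-close to $\max_{i\in S}x_i$. 2. If $k\ge n/2$, then there is a set $S\subseteq[n]$ with $|S|\le\max(1,C_2\sqrt{\epsilon}/p)$ such that $f$ or $1-f$ is $C_1\epsilon$-close to $\min_{i\in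 S}x_i$. 3. In particular, if $\epsilon\le c\,p^2$, then $f$ is $C_1\epsilon$-close to one of the functions $0,\ 1,\ x_i,\ 1-x_i$ ($i\in[n]$). -/

import Mathlib

namespace SliceFKN

open scoped BigOperators

/-- The slice: the subsets of `[n]` of size exactly `k`, i.e. the vectors in `{0,1}^n`
with coordinate sum `k`. -/
abbrev Slice (n k : ℕ) : Type := {A : Finset (Fin n) // A.card = k}

/-- The `i`-th coordinate `x_i ∈ {0,1}` of a point of the slice. -/
def coord {n k : ℕ} (i : Fin n) (x : Slice n k) : ℝ := if i ∈ x.1 then 1 else 0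

/-- The squared `L₂` norm `𝔼[f²]` with respect to the uniform distribution on a finite domain. -/
noncomputable def sqNorm {D : Type} [Fintype D] (f : D → ℝ) : ℝ :=
  Finset.expect Finset.univ fun x => f x ^ 2

/-- `f` and `g` are `ε`-close: `‖f - g‖² ≤ ε`. -/
def IsClose {D : Type} [Fintype D] (ε : ℝ) (f g : D → ℝ) : Prop :=
  sqNorm (fun x => f x - g x) ≤ ε

/-- A Boolean function is a `{0,1}`-valued function. -/
def IsBoolean {D : Type} (f : D → ℝ) : Prop := ∀ x, f x = 0 ∨ f x = 1

/-- Affine functions `c₀ + ∑ i, c i * x_i` on the slice. -/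
def IsAffine {n k : ℕ} (l : Slice n k → ℝ) : Prop :=
  ∃ (c₀ : ℝ) (c : Fin n → ℝ), ∀ x, l x = c₀ + ∑ i, c i * coord i x

/-- `max_{i ∈ S} x_i`, with the convention `max ∅ = 0`. -/
noncomputable def maxCoord {n k : ℕ} (S : Finset (Fin n)) (x : Slice n k) : ℝ :=
  S.fold max 0 fun i => coord i x

/-- `min_{i ∈ S} x_i`, with the convention `min ∅ = 1`. -/
noncomputable def minCoord {n k : ℕ} (S : Finset (Fin n)) (x : Slice n k) : ℝ :=
  S.fold min 1 fun i => coord i x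

/-- `p = min(k/n, 1 - k/n)`. -/
noncomputable def density (n k : ℕ) : ℝ := min ((k : ℝ) / n) (1 - (k : ℝ) / n)

end SliceFKN

/-! By complementation assume `2 * k ≤ n`, and let `f` be Boolean and near `c₀ + ∑ c i * x_i`.
Choosing `k` disjoint pairs of indices and one element from each pair embeds a `k`-dimensional cube
in the slice. For a random choice of pairs each point of this cube is uniform on the slice, so the
mean error on the cube is the error on the slice. In `±1` coordinates the affine function has
coefficients `(c a - c b) / 2` there, and the FKN theorem for the cube (`cube_fkn`) says that all
the differences `c a - c b` are nearly 0, except one that is near 0 or ±1.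

Averaging over the embedding gives three facts about `c`: differences are near integers, their mean
square is `O(1/k)`, and two disjoint pairs are seldom both far apart. Hence some `c j` is typical
(`exists_center`): only `O(n/k)` coefficients are at distance at least 1/2 from it. As `∑ x_i = k`,
subtracting `c j` from every coefficient changes only the constant. Rounding the differences then
costs `O(ε)`, since distinct coordinates are negatively correlated and the rounding errors have
small variance (`exists_integral_affine`).

The resulting integral function has support of size `O(n/k)`, which a random point avoids with
probability bounded below. So every trace on the support that forces an error is charged to `ε` at
nearly its full weight: the constant is 0 or 1, and coefficients outside `{0, 1}` and pairs of
coefficients 1 are rare (after replacing `f` by `1 - f` if the constant is 1). What remains agrees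
with a maximum up to `O(ε)` (`close_maxCoord_of_close_integral`). -/

namespace SliceFKN

open scoped BigOperators
open Finset

/-! ### Rademacher sums and their moments -/

section Cube

variable {ι : Type}

/-- The `±1` value of the `i`-th coordinate of a point of the cube. -/
def sgn (y : ι → Bool) (i : ι) : ℝ := if y i then 1 else -1

lemma sgn_sq (y : ι → Bool) (i : ι) : sgn y i ^ 2 = 1 := by
  unfold sgn; split_ifs <;> norm_num

variable [DecidableEq ι]

/-- Flip the coordinates in `A`. -/
def flipOn (A : Finset ι) (y : ι → Bool) : ι → Bool := fun i => if i ∈ A then !(y i) else y i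

/-- The Rademacher sum over `A`. -/
def rad (w : ι → ℝ) (A : Finset ι) (y : ι → Bool) : ℝ := ∑ i ∈ A, w i * sgn y i

lemma flipOn_involutive (A : Finset ι) : Function.Involutive (flipOn A) := by
  intro y
  funext i
  by_cases h : i ∈ A <;> simp [flipOn, h]

lemma sgn_flipOn (A : Finset ι) (y : ι → Bool) (i : ι) :
    sgn (flipOn A y) i = if i ∈ A then - sgn y i else sgn y i := by
  unfold sgn flipOn
  by_cases h : i ∈ A <;> cases y i <;> simp [h]

lemma rad_flipOn_of_subset (w : ι → ℝ) {A B : Finset ι} (h : B ⊆ A) (y : ι → Bool) :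
    rad w B (flipOn A y) = - rad w B y := by
  unfold rad
  rw [← sum_neg_distrib]
  refine sum_congr rfl fun i hi => ?_
  simp [sgn_flipOn, h hi]

lemma rad_flipOn_of_disjoint (w : ι → ℝ) {A B : Finset ι} (h : Disjoint A B) (y : ι → Bool) :
    rad w B (flipOn A y) = rad w B y := by
  unfold rad
  refine sum_congr rfl fun i hi => ?_
  simp [sgn_flipOn, disjoint_right.mp h hi]

lemma rad_insert (w : ι → ℝ) {A : Finset ι} {i : ι} (hi : i ∉ A) (y : ι → Bool) :
    rad w (insert i A) y = w i * sgn y i + rad w A y := by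
  simp [rad, sum_insert hi]

variable [Fintype ι]

lemma expect_flipOn (A : Finset ι) (Φ : (ι → Bool) → ℝ) :
    (𝔼 y, Φ (flipOn A y)) = 𝔼 y, Φ y :=
  Fintype.expect_equiv (flipOn_involutive A).toPerm _ _ fun _ => rfl

lemma expect_sgn_mul {i : ι} {Φ : (ι → Bool) → ℝ} (h : ∀ y, Φ (flipOn {i} y) = Φ y) :
    (𝔼 y, sgn y i * Φ y) = 0 := by
  have := expect_flipOn {i} (fun y => sgn y i * Φ y)
  simp only [h, sgn_flipOn, mem_singleton, if_true, neg_mul, expect_neg_distrib] at this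
  linarith

/-- Second moment of a Rademacher sum weighted by an independent factor. -/
lemma expect_rad_sq_mul (w : ι → ℝ) (A : Finset ι) {Ψ : (ι → Bool) → ℝ}
    (h : ∀ i ∈ A, ∀ y, Ψ (flipOn {i} y) = Ψ y) :
    (𝔼 y, rad w A y ^ 2 * Ψ y) = (∑ i ∈ A, w i ^ 2) * 𝔼 y, Ψ y := by
  induction A using Finset.induction_on with
  | empty => simp [rad]
  | insert i A hi ih =>
    have ih' := ih fun j hj => h j (mem_insert_of_mem hj)
    have h0 : (𝔼 y, sgn y i * (rad w A y * Ψ y)) = 0 := by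
      refine expect_sgn_mul fun y => ?_
      rw [rad_flipOn_of_disjoint w (by simpa using hi), h i (mem_insert_self i A)]
    have : ∀ y, rad w (insert i A) y ^ 2 * Ψ y =
        w i ^ 2 * Ψ y + (2 * w i) * (sgn y i * (rad w A y * Ψ y)) + rad w A y ^ 2 * Ψ y := by
      intro y
      rw [rad_insert w hi]
      linear_combination (w i ^ 2 * Ψ y) * sgn_sq y i
    simp only [this, expect_add_distrib, ← mul_expect, h0, ih', sum_insert hi]
    ring

/-- Fourth moment of a Rademacher sum weighted by an independent nonnegative factor. -/
lemma expect_rad_pow_four_mul_le (w : ι → ℝ) (A : Finset ι) {Ψ : (ι → Bool) → ℝ}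
    (h : ∀ i ∈ A, ∀ y, Ψ (flipOn {i} y) = Ψ y) (hΨ : ∀ y, 0 ≤ Ψ y) :
    (𝔼 y, rad w A y ^ 4 * Ψ y) ≤ 3 * (∑ i ∈ A, w i ^ 2) ^ 2 * 𝔼 y, Ψ y := by
  induction A using Finset.induction_on with
  | empty => simp [rad]
  | insert i A hi ih =>
    have hA : ∀ j ∈ A, ∀ y, Ψ (flipOn {j} y) = Ψ y := fun j hj => h j (mem_insert_of_mem hj)
    have ih' := ih hA
    have h2 := expect_rad_sq_mul w A hA
    have hr : ∀ y, rad w A (flipOn {i} y) = rad w A y :=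
      fun y => rad_flipOn_of_disjoint w (by simpa using hi) y
    have h1 : (𝔼 y, sgn y i * (rad w A y * Ψ y)) = 0 :=
      expect_sgn_mul fun y => by rw [hr, h i (mem_insert_self i A)]
    have h3 : (𝔼 y, sgn y i * (rad w A y ^ 3 * Ψ y)) = 0 :=
      expect_sgn_mul fun y => by rw [hr, h i (mem_insert_self i A)]
    have : ∀ y, rad w (insert i A) y ^ 4 * Ψ y =
        w i ^ 4 * Ψ y + (4 * w i ^ 3) * (sgn y i * (rad w A y * Ψ y))
          + (6 * w i ^ 2) * (rad w A y ^ 2 * Ψ y)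
          + (4 * w i) * (sgn y i * (rad w A y ^ 3 * Ψ y)) + rad w A y ^ 4 * Ψ y := by
      intro y
      rw [rad_insert w hi]
      linear_combination (w i ^ 4 * Ψ y * (sgn y i ^ 2 + 1) + 4 * w i ^ 3 * sgn y i * rad w A y * Ψ y
        + 6 * w i ^ 2 * rad w A y ^ 2 * Ψ y) * sgn_sq y i
    have hE : 0 ≤ 𝔼 y, Ψ y := expect_nonneg fun y _ => hΨ y
    simp only [this, expect_add_distrib, ← mul_expect, h1, h3, h2, sum_insert hi]
    nlinarith [mul_nonneg (pow_nonneg (sq_nonneg (w i)) 2) hE]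

/-- If the four corners of a parallelogram are close to `{0,1}`, one of its sides is short. -/
lemma min_sq_le_of_four_points {a X Y r₁ r₂ r₃ r₄ : ℝ}
    (h₁ : r₁ = 0 ∨ r₁ = 1) (h₂ : r₂ = 0 ∨ r₂ = 1) (h₃ : r₃ = 0 ∨ r₃ = 1) (h₄ : r₄ = 0 ∨ r₄ = 1) :
    4 * min (X ^ 2) (Y ^ 2) ≤ 6 * ((r₁ - (a + X + Y)) ^ 2 + (r₂ - (a - X + Y)) ^ 2
      + (r₃ - (a + X - Y)) ^ 2 + (r₄ - (a - X - Y)) ^ 2) := by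
  have hX := min_le_left (X ^ 2) (Y ^ 2)
  have hY := min_le_right (X ^ 2) (Y ^ 2)
  obtain ⟨d₁, rfl⟩ : ∃ d, r₁ = d + (a + X + Y) := ⟨r₁ - (a + X + Y), by ring⟩
  obtain ⟨d₂, rfl⟩ : ∃ d, r₂ = d + (a - X + Y) := ⟨r₂ - (a - X + Y), by ring⟩
  obtain ⟨d₃, rfl⟩ : ∃ d, r₃ = d + (a + X - Y) := ⟨r₃ - (a + X - Y), by ring⟩
  obtain ⟨d₄, rfl⟩ : ∃ d, r₄ = d + (a - X - Y) := ⟨r₄ - (a - X - Y), by ring⟩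
  simp only [add_sub_cancel_right]
  -- An edge whose ends carry the same Boolean value has the difference of two errors as its length.
  have side : ∀ {Z u v : ℝ}, 2 * Z = v - u → 4 * Z ^ 2 ≤ 2 * (u ^ 2 + v ^ 2) := by
    intro Z u v h
    obtain rfl : Z = (v - u) / 2 := by linarith
    nlinarith [sq_nonneg (u + v)]
  -- Otherwise the values alternate around the parallelogram. The mixed difference kills the affine
  -- part, so the errors combine to `±2` and their squares sum to at least 1, which pays for the
  -- jump `s` along the edge.
  have twist : ∀ {s : ℝ}, s ^ 2 = 1 → d₁ - d₂ - d₃ + d₄ = 2 * s → d₁ - d₂ + 2 * X = s →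
      4 * X ^ 2 ≤ 6 * (d₁ ^ 2 + d₂ ^ 2 + d₃ ^ 2 + d₄ ^ 2) := by
    intro s hs h h'
    have h4 : 4 ≤ 4 * (d₁ ^ 2 + d₂ ^ 2 + d₃ ^ 2 + d₄ ^ 2) := by
      have : (d₁ - d₂ - d₃ + d₄) ^ 2 = 4 := by rw [h]; linear_combination 4 * hs
      nlinarith [sq_nonneg (d₁ + d₂), sq_nonneg (d₁ + d₃), sq_nonneg (d₁ - d₄),
        sq_nonneg (d₂ - d₃), sq_nonneg (d₂ + d₄), sq_nonneg (d₃ + d₄)]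
    obtain rfl : X = (s - (d₁ - d₂)) / 2 := by linarith
    nlinarith [sq_nonneg (s + (d₁ - d₂)), sq_nonneg (d₁ + d₂), sq_nonneg d₃, sq_nonneg d₄]
  have p₁ := sq_nonneg d₁
  have p₂ := sq_nonneg d₂
  have p₃ := sq_nonneg d₃
  have p₄ := sq_nonneg d₄
  by_cases h12 : d₁ + (a + X + Y) = d₂ + (a - X + Y)
  · linarith [side (Z := X) (u := d₁) (v := d₂) (by linarith)]
  by_cases h34 : d₃ + (a + X - Y) = d₄ + (a - X - Y)
  · linarith [side (Z := X) (u := d₃) (v := d₄) (by linarith)]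
  by_cases h13 : d₁ + (a + X + Y) = d₃ + (a + X - Y)
  · linarith [side (Z := Y) (u := d₁) (v := d₃) (by linarith)]
  by_cases h24 : d₂ + (a - X + Y) = d₄ + (a - X - Y)
  · linarith [side (Z := Y) (u := d₂) (v := d₄) (by linarith)]
  rcases h₁ with h₁ | h₁ <;> rcases h₂ with h₂ | h₂ <;> rcases h₃ with h₃ | h₃ <;>
    rcases h₄ with h₄ | h₄ <;> first
    | exact absurd (h₁.trans h₂.symm) h12
    | exact absurd (h₃.trans h₄.symm) h34
    | exact absurd (h₁.trans h₃.symm) h13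
    | linarith [twist (s := 1) (by norm_num) (by linarith) (by linarith)]
    | linarith [twist (s := -1) (by norm_num) (by linarith) (by linarith)]

/-- For `a ≤ b` this is `a * (M - b) ^ 2 ≥ 0` with a term discarded. It bounds the minimum below by
a polynomial, whose expectation is computable from moments. -/
lemma quadratic_le_min {a b : ℝ} (ha : 0 ≤ a) (hb : 0 ≤ b) (M : ℝ) :
    2 * M * (a * b) - (a ^ 2 * b + b ^ 2 * a) ≤ M ^ 2 * min a b := by
  rcases le_total a b with h | h
  · rw [min_eq_left h]
    nlinarith [mul_nonneg ha (sq_nonneg (M - b)), mul_nonneg (mul_nonneg ha ha) hb]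
  · rw [min_eq_right h]
    nlinarith [mul_nonneg hb (sq_nonneg (M - a)), mul_nonneg (mul_nonneg hb hb) ha]

/-- If every bipartition of a family of weights has a light side, then the family is light apart
from a single element. -/
lemma exists_sum_erase_le [Nonempty ι] {α : ι → ℝ} (hα : ∀ i, 0 ≤ α i) {η : ℝ}
    (h : ∀ A : Finset ι, min (∑ i ∈ A, α i) (∑ i ∈ Aᶜ, α i) ≤ η) :
    ∃ i₀, ∑ i ∈ univ.erase i₀, α i ≤ 3 * η := by
  have hη : 0 ≤ η := by simpa [sum_nonneg fun i _ => hα i] using h ∅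
  by_cases hbig : ∃ i, η < α i
  · obtain ⟨i, hi⟩ := hbig
    refine ⟨i, ?_⟩
    have := h {i}
    rw [sum_singleton, min_le_iff] at this
    rcases this with h' | h'
    · linarith
    · have : univ.erase i = ({i} : Finset ι)ᶜ := by ext; simp
      rw [this]; linarith
  · push Not at hbig
    have key : ∀ A : Finset ι, ∑ i ∈ A, α i ≤ 3 * η := by
      intro A
      by_contra! hA
      -- Adding one element raises a sum from at most `η` to at most `2 * η`; a light complement
      -- would then make the total at most `3 * η`, so the sum itself must still be light.
      have key : ∀ B : Finset ι, ∑ i ∈ B, α i ≤ η := by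
        intro B
        induction B using Finset.induction_on with
        | empty => simpa using hη
        | insert i B hi ih =>
          have h2 := h (insert i B)
          rcases min_le_iff.mp h2 with h' | h'
          · exact h'
          · exfalso
            have hs := sum_add_sum_compl (insert i B) α
            have : ∑ i ∈ A, α i ≤ ∑ i, α i := sum_le_univ_sum_of_nonneg hα
            rw [sum_insert hi] at hs
            linarith [hbig i]
      linarith [key A]
    exact ⟨Classical.arbitrary ι, key _⟩

/-! ### The FKN theorem on the cube -/

section FKN

variable {F : (ι → Bool) → ℝ} {a : ℝ} {w : ι → ℝ}

/-- Flipping `A`, `Aᶜ` or everything preserves the uniform measure, so the four corners of the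
parallelogram spanned by the two partial sums have the same mean error. -/
lemma expect_min_rad_sq_le (hF : IsBoolean F) (A : Finset ι) :
    (𝔼 y, min (rad w A y ^ 2) (rad w Aᶜ y ^ 2)) ≤
      6 * 𝔼 y, (F y - (a + rad w univ y)) ^ 2 := by
  have hsplit : ∀ y, rad w univ y = rad w A y + rad w Aᶜ y := fun y =>
    (sum_add_sum_compl A _).symm
  have hd : Disjoint A Aᶜ := disjoint_compl_right
  have e1 := expect_flipOn A (fun y => (F y - (a + rad w univ y)) ^ 2)
  have e2 := expect_flipOn Aᶜ (fun y => (F y - (a + rad w univ y)) ^ 2)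
  have e3 := expect_flipOn univ (fun y => (F y - (a + rad w univ y)) ^ 2)
  have hp : ∀ y, 4 * min (rad w A y ^ 2) (rad w Aᶜ y ^ 2) ≤
      6 * ((F y - (a + rad w univ y)) ^ 2 + (F (flipOn A y) - (a + rad w univ (flipOn A y))) ^ 2
      + (F (flipOn Aᶜ y) - (a + rad w univ (flipOn Aᶜ y))) ^ 2
      + (F (flipOn univ y) - (a + rad w univ (flipOn univ y))) ^ 2) := by
    intro y
    have := min_sq_le_of_four_points (a := a) (X := rad w A y) (Y := rad w Aᶜ y) (hF y)
      (hF (flipOn A y)) (hF (flipOn Aᶜ y)) (hF (flipOn univ y))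
    refine this.trans (le_of_eq ?_)
    simp only [hsplit, rad_flipOn_of_subset w (subset_refl _), rad_flipOn_of_disjoint w hd,
      rad_flipOn_of_disjoint w hd.symm, rad_flipOn_of_subset w (subset_univ _)]
    ring
  have := expect_le_expect (s := univ) fun y _ => hp y
  simp only [← mul_expect, expect_add_distrib, e1, e2, e3] at this
  linarith

/-- The two partial sums are independent with fourth moments at most three times the squared
variances, so both are of the order of their standard deviations with positive probability. -/
lemma min_sum_sq_le_expect_min (A : Finset ι) :
    min (∑ i ∈ A, w i ^ 2) (∑ i ∈ Aᶜ, w i ^ 2) ≤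
      6 * 𝔼 y, min (rad w A y ^ 2) (rad w Aᶜ y ^ 2) := by
  set s := ∑ i ∈ A, w i ^ 2 with hs
  set t := ∑ i ∈ Aᶜ, w i ^ 2 with ht
  have hs0 : 0 ≤ s := sum_nonneg fun i _ => sq_nonneg _
  have ht0 : 0 ≤ t := sum_nonneg fun i _ => sq_nonneg _
  have hE0 : 0 ≤ 𝔼 y, min (rad w A y ^ 2) (rad w Aᶜ y ^ 2) :=
    expect_nonneg fun y _ => le_min (sq_nonneg _) (sq_nonneg _)
  rcases (add_nonneg hs0 ht0).eq_or_lt with h0 | hpos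
  · have : s = 0 := by linarith
    exact (min_le_left _ _).trans (by linarith)
  have hd : Disjoint A Aᶜ := disjoint_compl_right
  have hA : ∀ i ∈ A, ∀ y, rad w Aᶜ (flipOn {i} y) = rad w Aᶜ y := fun i hi y =>
    rad_flipOn_of_disjoint w (by simpa using hi) y
  have hB : ∀ i ∈ Aᶜ, ∀ y, rad w A (flipOn {i} y) = rad w A y := fun i hi y =>
    rad_flipOn_of_disjoint w (by simpa using hi) y
  have m2 : (𝔼 y, rad w Aᶜ y ^ 2) = t := by
    simpa using expect_rad_sq_mul w Aᶜ (Ψ := fun _ => 1) (by simp)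
  have m2' : (𝔼 y, rad w A y ^ 2) = s := by
    simpa using expect_rad_sq_mul w A (Ψ := fun _ => 1) (by simp)
  have m22 : (𝔼 y, rad w A y ^ 2 * rad w Aᶜ y ^ 2) = s * t := by
    rw [expect_rad_sq_mul w A (Ψ := fun y => rad w Aᶜ y ^ 2) fun i hi y => by simp only [hA i hi], m2]
  have m42 : (𝔼 y, rad w A y ^ 4 * rad w Aᶜ y ^ 2) ≤ 3 * s ^ 2 * t := by
    have := expect_rad_pow_four_mul_le w A (Ψ := fun y => rad w Aᶜ y ^ 2)
      (fun i hi y => by simp only [hA i hi]) fun y => sq_nonneg _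
    rwa [m2] at this
  have m24 : (𝔼 y, rad w Aᶜ y ^ 4 * rad w A y ^ 2) ≤ 3 * t ^ 2 * s := by
    have := expect_rad_pow_four_mul_le w Aᶜ (Ψ := fun y => rad w A y ^ 2)
      (fun i hi y => by simp only [hB i hi]) fun y => sq_nonneg _
    rwa [m2'] at this
  -- This `M` optimises the bound `(2 * M - 3 * (s + t)) * s * t ≤ M ^ 2 * E`.
  set M := 3 * (s + t) with hM
  have hq := expect_le_expect (s := univ) fun y _ =>
    quadratic_le_min (sq_nonneg (rad w A y)) (sq_nonneg (rad w Aᶜ y)) M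
  simp only [expect_sub_distrib, expect_add_distrib, ← mul_expect, ← pow_mul] at hq
  norm_num only [m22] at hq
  set E := 𝔼 y, min (rad w A y ^ 2) (rad w Aᶜ y ^ 2)
  have h1 : 3 * (s + t) * (s * t) ≤ 9 * (s + t) ^ 2 * E := by
    rw [hM] at hq; nlinarith
  have h2 : s * t ≤ 3 * (s + t) * E := by
    have : (s + t) * (s * t) ≤ (s + t) * (3 * (s + t) * E) := by nlinarith
    exact le_of_mul_le_mul_left this hpos
  have h3 : min s t * (s + t) ≤ 2 * (s * t) := by
    rcases le_total s t with h | h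
    · rw [min_eq_left h]; nlinarith
    · rw [min_eq_right h]; nlinarith
  have : (s + t) * min s t ≤ (s + t) * (6 * E) := by nlinarith
  exact le_of_mul_le_mul_left this hpos

/-- The Friedgut–Kalai–Naor theorem on the cube, in terms of the coefficients: a Boolean function
close to an affine function has at most one significant coefficient, which is close to `0, ±1`. -/
theorem cube_fkn [Nonempty ι] (hF : IsBoolean F) :
    ∃ (i₀ : ι) (e : ℤ), |e| ≤ 1 ∧
      ∑ i ∈ univ.erase i₀, (2 * w i) ^ 2 + (2 * w i₀ - e) ^ 2 ≤
        436 * 𝔼 y, (F y - (a + rad w univ y)) ^ 2 := by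
  set E := 𝔼 y, (F y - (a + rad w univ y)) ^ 2 with hE
  -- Here `36 = 6 * 6`. All weights but one sum to at most `108 * E`, hence `432 * E` after doubling
  -- the coefficients; the exceptional coefficient adds `4 * E`.
  obtain ⟨i₀, hi₀⟩ := exists_sum_erase_le (α := fun i => w i ^ 2) (fun i => sq_nonneg _)
    (η := 36 * E) fun A => by
      have := min_sum_sq_le_expect_min (w := w) A
      have := expect_min_rad_sq_le (a := a) (w := w) hF A
      linarith
  have e1 := expect_flipOn {i₀} (fun y => (F y - (a + rad w univ y)) ^ 2)
  -- Some edge in direction `i₀` has at most average error at its two ends. Along it `F` jumps by 0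
  -- or ±1 and the affine function by `±2 * w i₀`.
  have hex : ∃ y, 2 * ((F y - (a + rad w univ y)) ^ 2
      + (F (flipOn {i₀} y) - (a + rad w univ (flipOn {i₀} y))) ^ 2) ≤ 4 * E := by
    obtain ⟨y, -, hy⟩ := exists_le_of_expect_le (s := (univ : Finset (ι → Bool))) (a := 4 * E)
      (f := fun y => 2 * ((F y - (a + rad w univ y)) ^ 2
      + (F (flipOn {i₀} y) - (a + rad w univ (flipOn {i₀} y))) ^ 2)) univ_nonempty (by
        rw [← mul_expect, expect_add_distrib, e1]; linarith)
    exact ⟨y, hy⟩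
  obtain ⟨y, hy⟩ := hex
  have hr : rad w univ y = w i₀ * sgn y i₀ + rad w (univ.erase i₀) y := by
    rw [← rad_insert w (by simp), insert_erase (mem_univ i₀)]
  have hr' : rad w univ (flipOn {i₀} y) = - (w i₀ * sgn y i₀) + rad w (univ.erase i₀) y := by
    have : rad w univ (flipOn {i₀} y) = w i₀ * sgn (flipOn {i₀} y) i₀
        + rad w (univ.erase i₀) (flipOn {i₀} y) := by
      rw [← rad_insert w (by simp), insert_erase (mem_univ i₀)]
    rw [this, sgn_flipOn, rad_flipOn_of_disjoint w (by simp)]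
    simp
  have hlast : ∃ e : ℤ, |e| ≤ 1 ∧ (2 * w i₀ - e) ^ 2 ≤ 4 * E := by
    have hs : sgn y i₀ = 1 ∨ sgn y i₀ = -1 := by unfold sgn; split_ifs <;> simp
    rw [hr, hr'] at hy
    have key : ∃ e : ℤ, |e| ≤ 1 ∧ (e : ℝ) = (F y - F (flipOn {i₀} y)) * sgn y i₀ := by
      rcases hF y with h | h <;> rcases hF (flipOn {i₀} y) with h' | h' <;>
        rcases hs with h'' | h'' <;> rw [h, h', h'']
      all_goals first
        | (refine ⟨0, ?_, ?_⟩ <;> norm_num <;> done)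
        | (refine ⟨1, ?_, ?_⟩ <;> norm_num <;> done)
        | (refine ⟨-1, ?_, ?_⟩ <;> norm_num)
    obtain ⟨e, he, heq⟩ := key
    refine ⟨e, he, le_trans ?_ hy⟩
    rw [heq]
    generalize rad w (univ.erase i₀) y = R
    rcases hs with h'' | h'' <;> rw [h'']
    · nlinarith [sq_nonneg (F y - (a + (w i₀ * 1 + R)) + (F (flipOn {i₀} y) - (a + (-(w i₀ * 1) + R))))]
    · nlinarith [sq_nonneg (F y - (a + (w i₀ * -1 + R)) + (F (flipOn {i₀} y) - (a + (-(w i₀ * -1) + R))))]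
  obtain ⟨e, he, hle⟩ := hlast
  refine ⟨i₀, e, he, ?_⟩
  have : ∑ i ∈ univ.erase i₀, (2 * w i) ^ 2 = 4 * ∑ i ∈ univ.erase i₀, w i ^ 2 := by
    rw [mul_sum]; exact sum_congr rfl fun i _ => by ring
  rw [this]
  linarith

end FKN
end Cube

/-! ### Averaging over a transitive group action -/

section GroupAverage

variable {G α : Type} [Group G] [Fintype G] [MulAction G α] [Fintype α]

/-- Averaging over a transitive action is averaging over the orbit. -/
lemma expect_smul_eq_expect [MulAction.IsPretransitive G α] (a : α) (Φ : α → ℝ) :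
    (𝔼 g : G, Φ (g • a)) = 𝔼 x, Φ x := by
  have hconst : ∀ x : α, (𝔼 g : G, Φ (g • x)) = 𝔼 g : G, Φ (g • a) := by
    intro x
    obtain ⟨h, rfl⟩ := MulAction.exists_smul_eq G a x
    exact Fintype.expect_equiv (Equiv.mulRight h) _ _ fun g => by simp [mul_smul]
  have : Nonempty α := ⟨a⟩
  calc (𝔼 g : G, Φ (g • a)) = 𝔼 x : α, 𝔼 g : G, Φ (g • x) := by
        simp only [hconst, Fintype.expect_const]
    _ = 𝔼 g : G, 𝔼 x : α, Φ (g • x) := expect_comm _ _ _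
    _ = 𝔼 _g : G, 𝔼 x : α, Φ x := by
        refine expect_congr rfl fun g _ => ?_
        exact Fintype.expect_equiv (MulAction.toPerm g) _ _ fun x => rfl
    _ = 𝔼 x, Φ x := Fintype.expect_const _

end GroupAverage

/-! ### Random subcubes of the slice -/

section RandomCube

variable {n k : ℕ}

/-- Permutations of the coordinates act on the slice. -/
instance slicePermAction : MulAction (Equiv.Perm (Fin n)) (Slice n k) where
  smul g x := ⟨x.1.map g.toEmbedding, by rw [card_map]; exact x.2⟩
  one_smul x := Subtype.ext <| by
    change x.1.map (Equiv.toEmbedding 1) = x.1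
    exact map_refl
  mul_smul g h x := Subtype.ext <| by
    change x.1.map (Equiv.toEmbedding (g * h)) = (x.1.map h.toEmbedding).map g.toEmbedding
    rw [map_map]; rfl

lemma smul_slice_val (g : Equiv.Perm (Fin n)) (x : Slice n k) :
    (g • x).1 = x.1.map g.toEmbedding := rfl

instance slicePermAction_isPretransitive :
    MulAction.IsPretransitive (Equiv.Perm (Fin n)) (Slice n k) where
  exists_smul_eq x y := by
    let e : {i // i ∈ x.1} ≃ {i // i ∈ y.1} := Finset.equivOfCardEq (x.2.trans y.2.symm)
    refine ⟨e.extendSubtype, Subtype.ext ?_⟩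
    rw [smul_slice_val]
    refine eq_of_subset_of_card_le (fun i hi => ?_) (by rw [card_map, x.2, y.2])
    obtain ⟨j, hj, rfl⟩ := mem_map.mp hi
    exact e.extendSubtype_mem j hj

/-- The point of the slice which picks one element from each pair `t (i, true), t (i, false)`. -/
def cubePoint (t : Fin k × Bool ↪ Fin n) (y : Fin k → Bool) : Slice n k :=
  ⟨univ.map ⟨fun i => t (i, y i), fun i j h => congrArg Prod.fst (t.injective h)⟩, by simp⟩

lemma smul_cubePoint (g : Equiv.Perm (Fin n)) (t : Fin k × Bool ↪ Fin n) (y : Fin k → Bool) :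
    g • cubePoint t y = cubePoint (t.trans g.toEmbedding) y := by
  refine Subtype.ext ?_
  rw [smul_slice_val, cubePoint, map_map]
  rfl

lemma sum_mul_coord (c : Fin n → ℝ) (x : Slice n k) : ∑ i, c i * coord i x = ∑ i ∈ x.1, c i := by
  simp [coord, sum_ite_mem]

/-- The difference of the two coefficients of a pair. -/
def pairDiff (c : Fin n → ℝ) (t : Fin k × Bool ↪ Fin n) (i : Fin k) : ℝ :=
  c (t (i, true)) - c (t (i, false))

lemma affine_cubePoint (c₀ : ℝ) (c : Fin n → ℝ) (t : Fin k × Bool ↪ Fin n) (y : Fin k → Bool) :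
    c₀ + ∑ i, c i * coord i (cubePoint t y) =
      (c₀ + ∑ i, (c (t (i, true)) + c (t (i, false))) / 2)
        + rad (fun i => pairDiff c t i / 2) univ y := by
  rw [sum_mul_coord, cubePoint, sum_map, rad, add_assoc, ← sum_add_distrib]
  congr 1
  refine sum_congr rfl fun i _ => ?_
  change c (t (i, y i)) = _
  simp only [pairDiff, sgn]
  cases y i <;> simp <;> ring

/-- The mean squared error over a subcube of the slice. -/
noncomputable def cubeError (f l : Slice n k → ℝ) (t : Fin k × Bool ↪ Fin n) : ℝ :=
  𝔼 y, (f (cubePoint t y) - l (cubePoint t y)) ^ 2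

/-- Permutations act transitively on the slice, so each fixed vertex of a randomly permuted subcube
is uniform. -/
lemma expect_cubeError (f l : Slice n k → ℝ) (t : Fin k × Bool ↪ Fin n) :
    (𝔼 g : Equiv.Perm (Fin n), cubeError f l (t.trans g.toEmbedding)) =
      sqNorm fun x => f x - l x := by
  simp only [cubeError, ← smul_cubePoint]
  rw [expect_comm]
  simp only [expect_smul_eq_expect (G := Equiv.Perm (Fin n)) _
    (fun x : Slice n k => (f x - l x) ^ 2), Fintype.expect_const, sqNorm]

/-! ### Coefficient differences on one subcube -/

section Coefficients

variable {f l : Slice n k → ℝ} {c₀ : ℝ} {c : Fin n → ℝ}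

lemma exists_pairDiff_le (hk : 0 < k) (hf : IsBoolean f)
    (hl : ∀ x, l x = c₀ + ∑ i, c i * coord i x) (t : Fin k × Bool ↪ Fin n) :
    ∃ (i₀ : Fin k) (e : ℤ), |e| ≤ 1 ∧
      ∑ i ∈ univ.erase i₀, pairDiff c t i ^ 2 + (pairDiff c t i₀ - e) ^ 2 ≤
        436 * cubeError f l t := by
  have : Nonempty (Fin k) := ⟨⟨0, hk⟩⟩
  have := cube_fkn (F := fun y => f (cubePoint t y))
    (a := c₀ + ∑ i, (c (t (i, true)) + c (t (i, false))) / 2)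
    (w := fun i => pairDiff c t i / 2) (fun y => hf _)
  simpa only [cubeError, hl, affine_cubePoint, mul_div_cancel₀ _ (two_ne_zero' ℝ)] using this

/-- The nearest integer does at least as well as the integers 0 and `e` supplied by the cube
theorem. -/
lemma sum_sq_sub_round_pairDiff_le (hk : 0 < k) (hf : IsBoolean f)
    (hl : ∀ x, l x = c₀ + ∑ i, c i * coord i x) (t : Fin k × Bool ↪ Fin n) :
    ∑ i, (pairDiff c t i - round (pairDiff c t i)) ^ 2 ≤ 436 * cubeError f l t := by
  obtain ⟨i₀, e, -, h⟩ := exists_pairDiff_le hk hf hl t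
  refine le_trans ?_ h
  rw [← sum_erase_add _ _ (mem_univ i₀)]
  refine add_le_add (sum_le_sum fun i _ => ?_) (sq_le_sq.mpr (round_le _ _))
  have := round_le (pairDiff c t i) 0
  rw [Int.cast_zero, sub_zero] at this
  exact sq_le_sq.mpr this

lemma sum_sq_pairDiff_le (hk : 0 < k) (hf : IsBoolean f)
    (hl : ∀ x, l x = c₀ + ∑ i, c i * coord i x) (t : Fin k × Bool ↪ Fin n) :
    ∑ i, pairDiff c t i ^ 2 ≤ 2 + 872 * cubeError f l t := by
  obtain ⟨i₀, e, he, h⟩ := exists_pairDiff_le hk hf hl t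
  have he' : (e : ℝ) ^ 2 ≤ 1 := by
    have : |(e : ℝ)| ≤ 1 := by exact_mod_cast he
    rw [← sq_abs]; nlinarith [abs_nonneg (e : ℝ)]
  have hs : 0 ≤ ∑ i ∈ univ.erase i₀, pairDiff c t i ^ 2 := sum_nonneg fun i _ => sq_nonneg _
  rw [← sum_erase_add _ _ (mem_univ i₀)]
  nlinarith [sq_nonneg (pairDiff c t i₀ - 2 * e)]

/-- At most one of `i`, `j` is the exceptional index. -/
lemma min_sq_pairDiff_le (hk : 0 < k) (hf : IsBoolean f)
    (hl : ∀ x, l x = c₀ + ∑ i, c i * coord i x) (t : Fin k × Bool ↪ Fin n) {i j : Fin k}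
    (hij : i ≠ j) :
    min (pairDiff c t i ^ 2) (pairDiff c t j ^ 2) ≤ 436 * cubeError f l t := by
  obtain ⟨i₀, e, -, h⟩ := exists_pairDiff_le hk hf hl t
  have key : ∀ m, m ≠ i₀ → pairDiff c t m ^ 2 ≤ 436 * cubeError f l t := by
    intro m hm
    have := single_le_sum (f := fun i => pairDiff c t i ^ 2) (fun i _ => sq_nonneg _)
      (mem_erase.mpr ⟨hm, mem_univ m⟩)
    nlinarith [sq_nonneg (pairDiff c t i₀ - e)]
  by_cases hi : i = i₀
  · exact (min_le_right _ _).trans (key j fun hj => hij (hi.trans hj.symm))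
  · exact (min_le_left _ _).trans (key i hi)

end Coefficients

/-- The symmetric group is `r`-transitive, so `g ∘ t` is uniform among the injective tuples, of
which there are at most `n ^ r`. -/
lemma sum_injective_le_pow_mul_expect {r : ℕ} (t : Fin r ↪ Fin n) {Q : (Fin r → Fin n) → ℝ}
    (hQ : ∀ u, 0 ≤ Q u) :
    ∑ u : Fin r → Fin n with Function.Injective u, Q u ≤
      (n : ℝ) ^ r * 𝔼 g : Equiv.Perm (Fin n), Q fun i => g (t i) := by
  have := Equiv.Perm.isMultiplyPretransitive (Fin n) r
  have hQt := expect_smul_eq_expect (G := Equiv.Perm (Fin n)) t fun u => Q u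
  have hsum : ∑ u : Fin r → Fin n with Function.Injective u, Q u = ∑ u : Fin r ↪ Fin n, Q u := by
    symm
    refine sum_bij (fun u _ => (u : Fin r → Fin n)) (fun u _ => by simp [u.injective])
      (fun u _ v _ h => DFunLike.coe_injective h) (fun u hu => ⟨⟨u, (mem_filter.mp hu).2⟩, by simp⟩)
      fun u _ => rfl
  rw [hsum, ← Fintype.card_mul_expect, ← hQt]
  refine mul_le_mul_of_nonneg_right ?_ (expect_nonneg fun g _ => hQ _)
  have : Fintype.card (Fin r ↪ Fin n) ≤ n ^ r := by
    rw [Fintype.card_embedding_eq]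
    simpa using Nat.descFactorial_le_pow n r
  exact_mod_cast this

lemma exists_pairs_embedding (h : 2 * k ≤ n) : Nonempty (Fin k × Bool ↪ Fin n) :=
  Function.Embedding.nonempty_of_card_le (by simp; omega)

/-- Each of the `k` pairs is a uniform pair of distinct indices under a random permutation. Using
all of them at once gains the factor `k`, without which the rounding error could not be controlled
for sparse slices. -/
lemma sum_pairs_le (t : Fin k × Bool ↪ Fin n) (c : Fin n → ℝ) {H : ℝ → ℝ} (hH : ∀ v, 0 ≤ H v)
    (hH0 : H 0 = 0) :
    k * ∑ a, ∑ b, H (c a - c b) ≤ (n : ℝ) ^ 2 *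
      𝔼 g : Equiv.Perm (Fin n), ∑ i, H (pairDiff c (t.trans g.toEmbedding) i) := by
  have hpair : ∀ i : Fin k, ∑ a, ∑ b, H (c a - c b) ≤ (n : ℝ) ^ 2 *
      𝔼 g : Equiv.Perm (Fin n), H (pairDiff c (t.trans g.toEmbedding) i) := by
    intro i
    let u : Fin 2 ↪ Fin n := ⟨![t (i, true), t (i, false)], by
      intro a b; fin_cases a <;> fin_cases b <;> simp⟩
    refine le_trans ?_ (sum_injective_le_pow_mul_expect u (Q := fun u => H (c (u 0) - c (u 1)))
      fun u => hH _)
    rw [← sum_product', univ_product_univ, ← (finTwoArrowEquiv (Fin n)).sum_comp]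
    rw [← sum_filter_add_sum_filter_not univ fun u : Fin 2 → Fin n => Function.Injective u]
    refine le_of_eq (add_eq_left.mpr (sum_eq_zero fun u hu => ?_))
    have : u 0 = u 1 := by
      by_contra hne
      refine (mem_filter.mp hu).2 fun a b => ?_
      fin_cases a <;> fin_cases b <;> simp [hne, Ne.symm hne]
    change H (c (u 0) - c (u 1)) = 0
    rw [this, sub_self, hH0]
  have := sum_le_sum fun i (_ : i ∈ (univ : Finset (Fin k))) => hpair i
  rw [sum_const, card_univ, Fintype.card_fin, nsmul_eq_mul, ← mul_sum, ← expect_sum_comm] at this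
  exact this

/-! ### Global constraints on the coefficients -/

section Consequences

variable {f l : Slice n k → ℝ} {c₀ : ℝ} {c : Fin n → ℝ} {ε : ℝ}

lemma sum_sq_sub_round_le (hk : 0 < k) (hkn : 2 * k ≤ n) (hf : IsBoolean f)
    (hl : ∀ x, l x = c₀ + ∑ i, c i * coord i x) (hε : IsClose ε f l) :
    k * ∑ a, ∑ b, (c a - c b - round (c a - c b)) ^ 2 ≤ (n : ℝ) ^ 2 * (436 * ε) := by
  obtain ⟨t⟩ := exists_pairs_embedding hkn
  refine (sum_pairs_le t c (H := fun v => (v - round v) ^ 2) (fun v => sq_nonneg _)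
    (by simp)).trans (mul_le_mul_of_nonneg_left ?_ (by positivity))
  refine (expect_le_expect fun g _ =>
    sum_sq_sub_round_pairDiff_le hk hf hl (t.trans g.toEmbedding)).trans ?_
  rw [← mul_expect, expect_cubeError]
  exact mul_le_mul_of_nonneg_left hε (by norm_num)

lemma sum_sq_sub_le (hk : 0 < k) (hkn : 2 * k ≤ n) (hf : IsBoolean f)
    (hl : ∀ x, l x = c₀ + ∑ i, c i * coord i x) (hε : IsClose ε f l) :
    k * ∑ a, ∑ b, (c a - c b) ^ 2 ≤ (n : ℝ) ^ 2 * (2 + 872 * ε) := by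
  obtain ⟨t⟩ := exists_pairs_embedding hkn
  refine (sum_pairs_le t c (H := fun v => v ^ 2) (fun v => sq_nonneg _)
    (by simp)).trans (mul_le_mul_of_nonneg_left ?_ (by positivity))
  refine (expect_le_expect fun g _ =>
    sum_sq_pairDiff_le hk hf hl (t.trans g.toEmbedding)).trans ?_
  rw [expect_add_distrib, Fintype.expect_const, ← mul_expect, expect_cubeError]
  have : sqNorm (fun x => f x - l x) ≤ ε := hε
  linarith

/-- Few quadruples of distinct indices split into two pairs with different coefficients. -/
lemma card_quadruples_le (hk : 2 ≤ k) (hkn : 2 * k ≤ n) (hf : IsBoolean f)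
    (hl : ∀ x, l x = c₀ + ∑ i, c i * coord i x) (hε : IsClose ε f l) :
    (#{u : Fin 4 → Fin n | Function.Injective u ∧ 1 / 2 ≤ |c (u 0) - c (u 1)| ∧
      1 / 2 ≤ |c (u 2) - c (u 3)|} : ℝ) ≤ (n : ℝ) ^ 4 * (1744 * ε) := by
  obtain ⟨t⟩ := exists_pairs_embedding hkn
  let i : Fin k := ⟨0, by omega⟩
  let j : Fin k := ⟨1, by omega⟩
  have hij : i ≠ j := by simp [i, j]
  let v : Fin 4 ↪ Fin n := ⟨![t (i, true), t (i, false), t (j, true), t (j, false)], by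
    intro a b; fin_cases a <;> fin_cases b <;> simp [hij, hij.symm]⟩
  have h := sum_injective_le_pow_mul_expect v
    (Q := fun u => min ((c (u 0) - c (u 1)) ^ 2) ((c (u 2) - c (u 3)) ^ 2))
    fun u => le_min (sq_nonneg _) (sq_nonneg _)
  have h' : (𝔼 g : Equiv.Perm (Fin n), min ((c (g (v 0)) - c (g (v 1))) ^ 2)
      ((c (g (v 2)) - c (g (v 3))) ^ 2)) ≤ 436 * ε := by
    refine (expect_le_expect fun g _ => min_sq_pairDiff_le (by omega) hf hl
      (t.trans g.toEmbedding) hij).trans ?_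
    rw [← mul_expect, expect_cubeError]
    exact mul_le_mul_of_nonneg_left hε (by norm_num)
  -- Each counted quadruple contributes at least 1/4, whence `1744 = 4 * 436`.
  have hcard : (#{u : Fin 4 → Fin n | Function.Injective u ∧ 1 / 2 ≤ |c (u 0) - c (u 1)| ∧
      1 / 2 ≤ |c (u 2) - c (u 3)|} : ℝ) * (1 / 4) ≤ ∑ u : Fin 4 → Fin n with Function.Injective u,
        min ((c (u 0) - c (u 1)) ^ 2) ((c (u 2) - c (u 3)) ^ 2) := by
    rw [← filter_filter, ← nsmul_eq_mul]
    refine (card_nsmul_le_sum _ (fun u => min ((c (u 0) - c (u 1)) ^ 2) ((c (u 2) - c (u 3)) ^ 2))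
      _ fun u hu => ?_).trans
      (sum_le_sum_of_subset_of_nonneg (filter_subset _ _) fun u _ _ =>
        le_min (sq_nonneg _) (sq_nonneg _))
    obtain ⟨h1, h2⟩ := (mem_filter.mp hu).2
    refine le_min ?_ ?_ <;> rw [← sq_abs] <;> nlinarith
  have := mul_le_mul_of_nonneg_left h' (by positivity : (0 : ℝ) ≤ (n : ℝ) ^ 4)
  linarith

end Consequences

end RandomCube

/-! ### A typical coefficient -/

section Center

variable {n : ℕ} {c : Fin n → ℝ}

/-- The indices whose coefficient is far from the `j`-th one. -/
noncomputable def farSet (c : Fin n → ℝ) (j : Fin n) : Finset (Fin n) :=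
  {i | 1 / 2 ≤ |c i - c j|}

/-- The injective quadruples which split into two pairs with far coefficients. -/
noncomputable def farQuadruples (c : Fin n → ℝ) : Finset (Fin 4 → Fin n) :=
  {u | Function.Injective u ∧ 1 / 2 ≤ |c (u 0) - c (u 1)| ∧ 1 / 2 ≤ |c (u 2) - c (u 3)|}

lemma mem_farSet {i j : Fin n} : i ∈ farSet c j ↔ 1 / 2 ≤ |c i - c j| := by simp [farSet]

lemma mem_farSet_comm {i j : Fin n} : i ∈ farSet c j ↔ j ∈ farSet c i := by
  rw [mem_farSet, mem_farSet, abs_sub_comm]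

lemma ne_of_mem_farSet {i j : Fin n} (h : i ∈ farSet c j) : i ≠ j := by
  rintro rfl
  rw [mem_farSet, sub_self, abs_zero] at h
  norm_num at h

lemma mem_farQuadruples {a b a' b' : Fin n} (h : b ∈ farSet c a) (hfar : b' ∈ farSet c a')
    (h1 : a ≠ a') (h2 : a ≠ b') (h3 : b ≠ a') (h4 : b ≠ b') :
    ![a, b, a', b'] ∈ farQuadruples c := by
  have hab := ne_of_mem_farSet h
  have hab' := ne_of_mem_farSet hfar
  refine mem_filter.mpr ⟨mem_univ _, ?_, ?_, ?_⟩
  · intro i j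
    fin_cases i <;> fin_cases j <;>
      simp [h1, h2, h3, h4, hab, hab', h1.symm, h2.symm, h3.symm, h4.symm, hab.symm, hab'.symm]
  · simpa [mem_farSet] using mem_farSet_comm.mp h
  · simpa [mem_farSet] using mem_farSet_comm.mp hfar

/-- Without far quadruples, some coefficient is close to all others but one. -/
lemma exists_card_farSet_le_one (hn : 4 ≤ n) (h : farQuadruples c = ∅) :
    ∃ j, #(farSet c j) ≤ 1 := by
  have hno : ∀ {a b a' b' : Fin n}, b ∈ farSet c a → b' ∈ farSet c a' → a ≠ a' → a ≠ b' →
      b ≠ a' → b ≠ b' → False := fun h₁ h₂ h₃ h₄ h₅ h₆ => by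
    have := mem_farQuadruples h₁ h₂ h₃ h₄ h₅ h₆
    simp [h] at this
  by_cases hall : ∀ j, farSet c j = ∅
  · exact ⟨⟨0, by omega⟩, by simp [hall]⟩
  push Not at hall
  obtain ⟨a, b, hb⟩ := hall
  have hab := ne_of_mem_farSet hb
  have hcard : 2 ≤ #(({a, b} : Finset (Fin n))ᶜ) := by
    rw [card_compl, Fintype.card_fin]
    have := card_le_two (a := a) (b := b)
    omega
  obtain ⟨z, hz, z', hz', hzz⟩ := one_lt_card.mp hcard
  simp only [mem_compl, mem_insert, mem_singleton, not_or] at hz hz'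
  have hsub : ∀ {z : Fin n}, z ≠ a ∧ z ≠ b → farSet c z ⊆ {a, b} := by
    intro z hz i hi
    by_contra hi'
    simp only [mem_insert, mem_singleton, not_or] at hi'
    exact hno hb hi hz.1.symm (Ne.symm hi'.1) hz.2.symm (Ne.symm hi'.2)
  have : Nonempty (Fin n) := ⟨a⟩
  -- Outside `{a, b}` every index can be far only from `a` or `b`. If `z` is far from `a`, then `z'`
  -- is not far from `b`, since the two pairs would form a far quadruple.
  by_cases haz : a ∈ farSet c z
  · refine ⟨z', card_le_one_iff_subset_singleton.mpr ⟨a, fun i hi => ?_⟩⟩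
    rcases mem_insert.mp (hsub hz' hi) with rfl | hib
    · simp
    · rw [mem_singleton] at hib
      subst hib
      exact (hno haz hi hzz hz.2 (Ne.symm hz'.1) hab.symm).elim
  · refine ⟨z, card_le_one_iff_subset_singleton.mpr ⟨b, fun i hi => ?_⟩⟩
    rcases mem_insert.mp (hsub hz hi) with rfl | hib
    · exact absurd hi haz
    · exact hib

/-- The indices with few far coefficients. -/
noncomputable def centralSet (c : Fin n → ℝ) : Finset (Fin n) := {j | 4 * #(farSet c j) ≤ n}

/-- Choose `a`, `b`, `a'`, `b'` greedily with `a`, `a'` not central: there are at least `n/2`,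
`n/4`, `n/2` and `n/4 - 2 ≥ n/8` choices, the last because `n ≥ 16`. -/
lemma pow_four_le_card_farQuadruples (hn : 16 ≤ n) (h : 16 * #(centralSet c) < n) :
    n ^ 4 ≤ 128 * #(farQuadruples c) := by
  set N := (centralSet c)ᶜ with hN
  have hNcard : 15 * n ≤ 16 * #N := by
    rw [hN, card_compl, Fintype.card_fin]; omega
  have hNfar : ∀ a ∈ N, n ≤ 4 * #(farSet c a) := by
    intro a ha
    simp only [hN, centralSet, mem_compl, mem_filter, mem_univ, true_and, not_le] at ha
    exact ha.le
  let T : Finset (Σ _ : Fin n, Σ _ : Fin n, Σ _ : Fin n, Fin n) :=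
    N.sigma fun a => (farSet c a).sigma fun b => (N \ {a, b}).sigma fun a' => farSet c a' \ {a, b}
  have hT : #T ≤ #(farQuadruples c) := by
    refine card_le_card_of_injOn (fun q => ![q.1, q.2.1, q.2.2.1, q.2.2.2]) ?_ ?_
    · rintro ⟨a, b, a', b'⟩ hq
      simp only [T, coe_sigma, Set.mem_sigma_iff, mem_coe, mem_sdiff, mem_insert,
        mem_singleton, not_or] at hq
      obtain ⟨-, hb, ⟨-, h1, h2⟩, hb', h3, h4⟩ := hq
      exact mem_farQuadruples hb hb' (Ne.symm h1) (Ne.symm h3) (Ne.symm h2) (Ne.symm h4)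
    · rintro ⟨a, b, a', b'⟩ - ⟨x, y, x', y'⟩ - hxy
      simpa using hxy
  have h4 : ∀ a b, ∀ a' ∈ N \ {a, b}, n ≤ 8 * #(farSet c a' \ {a, b}) := by
    intro a b a' ha'
    have h1 := hNfar a' (mem_sdiff.mp ha').1
    have h2 := le_card_sdiff {a, b} (farSet c a')
    have h3 := card_le_two (a := a) (b := b)
    omega
  have h3 : ∀ a b, n * n ≤ 16 * #((N \ {a, b}).sigma fun a' => farSet c a' \ {a, b}) := by
    intro a b
    rw [card_sigma, mul_sum]
    have h2 := le_card_sdiff {a, b} N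
    have h3 := card_le_two (a := a) (b := b)
    have h5 : n ≤ 2 * #(N \ {a, b}) := by omega
    calc n * n ≤ #(N \ {a, b}) * (2 * n) := by nlinarith
      _ ≤ _ := by
        rw [← smul_eq_mul]
        exact card_nsmul_le_sum _ _ _ fun a' ha' => by have := h4 a b a' ha'; omega
  have h2 : ∀ a ∈ N, n * (n * n) ≤ 64 * #((farSet c a).sigma fun b => (N \ {a, b}).sigma fun a' =>
      farSet c a' \ {a, b}) := by
    intro a ha
    rw [card_sigma, mul_sum]
    calc n * (n * n) ≤ #(farSet c a) * (4 * (n * n)) := by nlinarith [hNfar a ha]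
      _ ≤ _ := by
        rw [← smul_eq_mul]
        exact card_nsmul_le_sum _ _ _ fun b _ => by have := h3 a b; omega
  have h1 : n * (n * (n * n)) ≤ 128 * #T := by
    simp only [T]
    rw [card_sigma, mul_sum]
    have hn2 : n ≤ 2 * #N := by omega
    calc n * (n * (n * n)) ≤ #N * (2 * (n * (n * n))) := by
          have := Nat.mul_le_mul_right (n * (n * n)) hn2
          linarith
      _ ≤ _ := by
        rw [← smul_eq_mul]
        exact card_nsmul_le_sum _ _ _ fun a ha => by have := h2 a ha; omega
  calc n ^ 4 = n * (n * (n * n)) := by ring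
    _ ≤ 128 * #T := h1
    _ ≤ _ := Nat.mul_le_mul_left _ hT

/-- Since `65536 = 16 ^ 4`, for `n < 16` the hypothesis rules out far quadruples altogether and one
central index suffices; for larger `n` counting applies. -/
lemma le_card_centralSet (hn : 4 ≤ n) (h : 65536 * #(farQuadruples c) < n ^ 4) :
    n ≤ 16 * #(centralSet c) := by
  rcases lt_or_ge n 16 with hlt | hge
  · have h16 : n ^ 4 ≤ 16 ^ 4 := Nat.pow_le_pow_left hlt.le 4
    have h0 : farQuadruples c = ∅ := by rw [← card_eq_zero]; omega
    obtain ⟨j, hj⟩ := exists_card_farSet_le_one hn h0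
    have : 0 < #(centralSet c) := card_pos.mpr ⟨j, by simp [centralSet]; omega⟩
    omega
  · by_contra! hlt
    have := pow_four_le_card_farQuadruples hge hlt
    omega

/-- Choice of a typical coefficient. -/
lemma exists_center {k : ℕ} {ρ : ℝ} (hk : 0 < k) (hn : 4 ≤ n)
    (hquad : 65536 * #(farQuadruples c) < n ^ 4)
    (hsq : k * ∑ a, ∑ b, (c a - c b) ^ 2 ≤ (n : ℝ) ^ 2 * 4)
    (hround : k * ∑ a, ∑ b, (c a - c b - round (c a - c b)) ^ 2 ≤ (n : ℝ) ^ 2 * ρ) :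
    ∃ j, 4 * #(farSet c j) ≤ n ∧ (k : ℝ) * #(farSet c j) ≤ 512 * n ∧
      k * ∑ i, (c i - c j - round (c i - c j)) ^ 2 ≤ 32 * n * ρ := by
  have hn0 : (0 : ℝ) < n := by exact_mod_cast (by omega : 0 < n)
  have hk0 : (0 : ℝ) < k := by exact_mod_cast hk
  have hJ := le_card_centralSet hn hquad
  set A : Fin n → ℝ := fun j => k * ∑ i, (c i - c j) ^ 2 with hA
  have hA0 : ∀ j, 0 ≤ A j := fun j => mul_nonneg hk0.le (sum_nonneg fun i _ => sq_nonneg _)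
  set R : Fin n → ℝ := fun j => k * ∑ i, (c i - c j - round (c i - c j)) ^ 2 with hR
  have hR0 : ∀ j, 0 ≤ R j := fun j => mul_nonneg hk0.le (sum_nonneg fun i _ => sq_nonneg _)
  have hAsum : ∑ j, A j ≤ (n : ℝ) ^ 2 * 4 := by
    rw [sum_comm, mul_sum] at hsq; exact hsq
  have hRsum : ∑ j, R j ≤ (n : ℝ) ^ 2 * ρ := by
    rw [sum_comm, mul_sum] at hround; exact hround
  set J := centralSet c with hJdef
  set J₁ := J.filter fun j => A j ≤ 128 * n with hJ₁
  -- Markov's inequality: at most `n / 32` indices have `A j > 128 * n`, so half of the `n / 16`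
  -- guaranteed central indices survive.
  have hbad : (#(J.filter fun j => ¬ A j ≤ 128 * n) : ℝ) * (128 * n) ≤ (n : ℝ) ^ 2 * 4 := by
    refine le_trans ?_ hAsum
    rw [← nsmul_eq_mul]
    exact (card_nsmul_le_sum _ A _ fun j hj => (not_le.mp (mem_filter.mp hj).2).le).trans
      (sum_le_univ_sum_of_nonneg hA0)
  have hsplit := card_filter_add_card_filter_not (s := J) fun j => A j ≤ 128 * n
  have hJ₁card : (n : ℝ) ≤ 32 * #J₁ := by
    have e1 : (#J₁ : ℝ) + #(J.filter fun j => ¬ A j ≤ 128 * n) = #J := by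
      rw [hJ₁]; exact_mod_cast hsplit
    have e2 : (n : ℝ) ≤ 16 * #J := by exact_mod_cast hJ
    have e3 : (#(J.filter fun j => ¬ A j ≤ 128 * n) : ℝ) * 32 ≤ n := by
      refine le_of_mul_le_mul_right ?_ hn0
      nlinarith
    linarith
  have hJ₁ne : J₁.Nonempty := by
    rw [← card_pos]
    have : (0 : ℝ) < #J₁ := by linarith
    exact_mod_cast this
  obtain ⟨j, hj, hjR⟩ : ∃ j ∈ J₁, R j ≤ 32 * n * ρ := by
    refine exists_le_of_sum_le hJ₁ne ?_
    refine (sum_le_univ_sum_of_nonneg hR0).trans (hRsum.trans ?_)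
    have hρ : 0 ≤ ρ := by
      have : 0 ≤ (n : ℝ) ^ 2 * ρ := (sum_nonneg fun j _ => hR0 j).trans hRsum
      exact nonneg_of_mul_nonneg_right this (by positivity)
    rw [sum_const, nsmul_eq_mul]
    nlinarith [mul_nonneg hn0.le hρ]
  obtain ⟨hjJ, hjA⟩ := mem_filter.mp hj
  refine ⟨j, by simpa [hJdef, centralSet] using hjJ, ?_, hjR⟩
  have : (#(farSet c j) : ℝ) * (1 / 4) ≤ ∑ i, (c i - c j) ^ 2 := by
    rw [← nsmul_eq_mul]
    refine (card_nsmul_le_sum _ (fun i => (c i - c j) ^ 2) _ fun i hi => ?_).trans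
      (sum_le_univ_sum_of_nonneg fun i => sq_nonneg _)
    rw [← sq_abs]
    nlinarith [mem_farSet.mp hi]
  have := mul_le_mul_of_nonneg_left this hk0.le
  simp only [hA] at hjA
  linarith

end Center

/-! ### Moments of coordinates on the slice -/

section Moments

variable {n k : ℕ}

lemma card_slice : Fintype.card (Slice n k) = n.choose k := by
  rw [Fintype.card_finset_len, Fintype.card_fin]

lemma slice_nonempty (h : k ≤ n) : Nonempty (Slice n k) := by
  rw [← Fintype.card_pos_iff, card_slice]
  exact Nat.choose_pos h

/-- The number of points of the slice with a prescribed trace on `S`. -/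
lemma card_inter_eq {S T : Finset (Fin n)} (hT : T ⊆ S) (hk : #T ≤ k) :
    #{x : Slice n k | x.1 ∩ S = T} = (n - #S).choose (k - #T) := by
  have hcompl : #Sᶜ = n - #S := by rw [card_compl, Fintype.card_fin]
  rw [← hcompl, ← card_powersetCard]
  refine card_bij (fun x _ => x.1 \ S) ?_ ?_ ?_
  · intro x hx
    have hx' := (mem_filter.mp hx).2
    refine mem_powersetCard.mpr ⟨fun i hi => mem_compl.mpr (mem_sdiff.mp hi).2, ?_⟩
    have := card_sdiff_add_card_inter x.1 S
    rw [hx', x.2] at this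
    omega
  · intro x hx y hy hxy
    refine Subtype.ext ?_
    rw [← sdiff_union_inter x.1 S, ← sdiff_union_inter y.1 S, (mem_filter.mp hx).2,
      (mem_filter.mp hy).2, hxy]
  · intro y hy
    obtain ⟨hyS, hyc⟩ := mem_powersetCard.mp hy
    have hd : Disjoint y S := disjoint_left.mpr fun i hi => mem_compl.mp (hyS hi)
    have hdT : Disjoint y T := disjoint_of_subset_right hT hd
    refine ⟨⟨y ∪ T, ?_⟩, mem_filter.mpr ⟨mem_univ _, ?_⟩, ?_⟩
    · rw [card_union_of_disjoint hdT, hyc]; omega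
    · rw [union_inter_distrib_right, disjoint_iff_inter_eq_empty.mp hd, empty_union,
        inter_eq_left.mpr hT]
    · rw [union_sdiff_distrib, sdiff_eq_self_of_disjoint hd, sdiff_eq_empty_iff_subset.mpr hT,
        union_empty]

lemma expect_inter_eq {S T : Finset (Fin n)} (hT : T ⊆ S) (hk : #T ≤ k) :
    (𝔼 x : Slice n k, if x.1 ∩ S = T then (1 : ℝ) else 0) =
      (n - #S).choose (k - #T) / n.choose k := by
  rw [Fintype.expect_eq_sum_div_card, card_slice, sum_boole, card_inter_eq hT hk]

lemma coord_mul_coord_self (i : Fin n) (x : Slice n k) : coord i x * coord i x = coord i x := by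
  unfold coord; split_ifs <;> norm_num

lemma expect_coord (hk : 0 < k) (hkn : k ≤ n) (i : Fin n) :
    (𝔼 x : Slice n k, coord i x) = k / n := by
  have h := expect_inter_eq (n := n) (k := k) (subset_refl {i})
    (by rw [card_singleton]; exact hk)
  have : ∀ x : Slice n k, coord i x = if x.1 ∩ {i} = {i} then (1 : ℝ) else 0 := by
    intro x
    simp [coord]
  simp only [this, h, card_singleton]
  obtain ⟨k, rfl⟩ := Nat.exists_eq_add_of_le' hk
  obtain ⟨n, rfl⟩ := Nat.exists_eq_add_of_le' (hk.trans_le hkn)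
  have h0 : (0 : ℝ) < (n + 1).choose (k + 1) := by exact_mod_cast Nat.choose_pos hkn
  have := Nat.add_one_mul_choose_eq n k
  rw [Nat.add_sub_cancel, Nat.add_sub_cancel, div_eq_div_iff h0.ne' (by positivity)]
  push_cast
  have : ((n : ℝ) + 1) * n.choose k = (n + 1).choose (k + 1) * (k + 1) := by exact_mod_cast this
  linarith

lemma expect_coord_mul_coord (hk : 2 ≤ k) (hkn : k ≤ n) {i j : Fin n} (hij : i ≠ j) :
    (𝔼 x : Slice n k, coord i x * coord j x) = k * (k - 1) / (n * (n - 1)) := by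
  have h := expect_inter_eq (n := n) (k := k) (subset_refl {i, j}) (by simpa [card_pair hij] using hk)
  have : ∀ x : Slice n k, coord i x * coord j x =
      if x.1 ∩ {i, j} = {i, j} then (1 : ℝ) else 0 := by
    intro x
    simp only [coord, inter_eq_right, insert_subset_iff, singleton_subset_iff]
    by_cases h1 : i ∈ x.1 <;> by_cases h2 : j ∈ x.1 <;> simp [h1, h2]
  simp only [this, h, card_pair hij]
  obtain ⟨k, rfl⟩ := Nat.exists_eq_add_of_le' hk
  obtain ⟨n, rfl⟩ := Nat.exists_eq_add_of_le' (hk.trans hkn)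
  have h0 : (0 : ℝ) < (n + 2).choose (k + 2) := by exact_mod_cast Nat.choose_pos hkn
  have e1 : ((n : ℝ) + 1) * n.choose k = (n + 1).choose (k + 1) * (k + 1) := by
    exact_mod_cast Nat.add_one_mul_choose_eq n k
  have e2 : ((n : ℝ) + 2) * (n + 1).choose (k + 1) = (n + 2).choose (k + 2) * (k + 2) := by
    exact_mod_cast Nat.add_one_mul_choose_eq (n + 1) (k + 1)
  have hn1 : ((n + 2 : ℕ) : ℝ) - 1 = n + 1 := by push_cast; ring
  have hk1 : ((k + 2 : ℕ) : ℝ) - 1 = k + 1 := by push_cast; ring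
  rw [Nat.add_sub_cancel, Nat.add_sub_cancel, hn1, hk1,
    div_eq_div_iff h0.ne' (by positivity)]
  push_cast
  linear_combination ((n : ℝ) + 2) * e1 + ((k : ℝ) + 1) * e2

/-- Distinct coordinates are negatively correlated; this is what removes the square of `∑ δ i` from
the variance bound. -/
lemma pair_density_le (hk : 1 ≤ k) (hkn : k ≤ n) (hn : 2 ≤ n) :
    (k : ℝ) * (k - 1) / (n * (n - 1)) ≤ (k / n) ^ 2 := by
  have h1 : (1 : ℝ) ≤ k := by exact_mod_cast hk
  have h2 : (k : ℝ) ≤ n := by exact_mod_cast hkn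
  have h3 : (2 : ℝ) ≤ n := by exact_mod_cast hn
  rw [div_pow, div_le_div_iff₀ (by nlinarith) (by positivity)]
  have : 0 ≤ (k : ℝ) * n * (n - k) := by
    apply mul_nonneg <;> nlinarith
  nlinarith

/-- Variance of a linear function on the slice. -/
lemma sqNorm_linear_sub_mean_le (hk : 2 ≤ k) (hkn : k ≤ n) (δ : Fin n → ℝ) :
    sqNorm (fun x : Slice n k => ∑ i, δ i * coord i x - (k / n : ℝ) * ∑ i, δ i) ≤
      (k / n : ℝ) * ∑ i, δ i ^ 2 := by
  have := slice_nonempty hkn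
  set p : ℝ := k / n with hp
  set q : ℝ := k * (k - 1) / (n * (n - 1)) with hq
  have hqp : q ≤ p ^ 2 := pair_density_le (by omega) hkn (by omega)
  have hq0 : 0 ≤ q := by
    have h1 : (2 : ℝ) ≤ k := by exact_mod_cast hk
    have h2 : (k : ℝ) ≤ n := by exact_mod_cast hkn
    apply div_nonneg <;> nlinarith
  have hE : ∀ i j, (𝔼 x : Slice n k, coord i x * coord j x) = q + if i = j then p - q else 0 := by
    intro i j
    split_ifs with h
    · subst h
      simp only [coord_mul_coord_self, expect_coord (by omega : 0 < k) hkn]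
      ring
    · rw [expect_coord_mul_coord hk hkn h, add_zero]
  set D := ∑ i, δ i with hD
  have h1 : (𝔼 x : Slice n k, ∑ i, δ i * coord i x) = p * D := by
    rw [expect_sum_comm, hD, mul_sum]
    refine sum_congr rfl fun i _ => ?_
    rw [← mul_expect, expect_coord (by omega) hkn, mul_comm]
  have h2 : (𝔼 x : Slice n k, (∑ i, δ i * coord i x) ^ 2) = q * D ^ 2 + (p - q) * ∑ i, δ i ^ 2 := by
    have : ∀ x : Slice n k, (∑ i, δ i * coord i x) ^ 2 =
        ∑ i, ∑ j, (δ i * δ j) * (coord i x * coord j x) := by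
      intro x
      rw [sq, sum_mul_sum]
      exact sum_congr rfl fun i _ => sum_congr rfl fun j _ => by ring
    simp only [this, expect_sum_comm, ← mul_expect, hE, mul_add, sum_add_distrib, mul_ite, mul_zero,
      sum_ite_eq, mem_univ, if_true]
    rw [hD, sq, sum_mul_sum, mul_sum, mul_sum]
    congr 1
    · refine sum_congr rfl fun i _ => ?_
      rw [mul_sum]
      exact sum_congr rfl fun j _ => by ring
    · exact sum_congr rfl fun i _ => by ring
  have h3 : sqNorm (fun x : Slice n k => ∑ i, δ i * coord i x - p * D) =
      q * D ^ 2 + (p - q) * ∑ i, δ i ^ 2 - (p * D) ^ 2 := by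
    have : ∀ x : Slice n k, (∑ i, δ i * coord i x - p * D) ^ 2 =
        (∑ i, δ i * coord i x) ^ 2 - (2 * (p * D)) * (∑ i, δ i * coord i x) + (p * D) ^ 2 :=
      fun x => by ring
    simp only [sqNorm, this, expect_add_distrib, expect_sub_distrib, ← mul_expect, h1, h2,
      Fintype.expect_const]
    ring
  rw [h3]
  have hs : 0 ≤ ∑ i, δ i ^ 2 := sum_nonneg fun i _ => sq_nonneg _
  nlinarith [mul_nonneg (sub_nonneg.mpr hqp) (sq_nonneg D), mul_nonneg hq0 hs]

end Moments

/-! ### Rounding to an integral affine function -/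

section Rounding

variable {n k : ℕ} {f l : Slice n k → ℝ} {c₀ : ℝ} {c : Fin n → ℝ} {ε : ℝ}

/-- A Boolean function close to an affine function is close to an integral affine function with
few nonzero coefficients. -/
theorem exists_integral_affine (hk : 2 ≤ k) (hkn : 2 * k ≤ n) (hf : IsBoolean f)
    (hl : ∀ x, l x = c₀ + ∑ i, c i * coord i x) (hε : IsClose ε f l)
    (hsmall : ε ≤ 1 / 2 ^ 27) :
    ∃ (b : ℤ) (e : Fin n → ℤ), 4 * #{i | e i ≠ 0} ≤ n ∧ (k : ℝ) * #{i | e i ≠ 0} ≤ 512 * n ∧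
      sqNorm (fun x => f x - (b + ∑ i, e i * coord i x)) ≤ 111624 * ε := by
  have := slice_nonempty (show k ≤ n by omega)
  have hn0 : (0 : ℝ) < n := by exact_mod_cast (by omega : 0 < n)
  have hk0 : (0 : ℝ) < k := by exact_mod_cast (by omega : 0 < k)
  -- The threshold on `ε` is chosen for this: `65536 * 1744 < 2 ^ 27`.
  have hquad : 65536 * #(farQuadruples c) < n ^ 4 := by
    have h : (#(farQuadruples c) : ℝ) ≤ (n : ℝ) ^ 4 * (1744 * ε) :=
      card_quadruples_le hk hkn hf hl hε
    have h4 : (0 : ℝ) < (n : ℝ) ^ 4 := by positivity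
    have : (65536 * #(farQuadruples c) : ℝ) < (n : ℝ) ^ 4 := by
      have h5 : 65536 * (1744 * ε) ≤ 65536 * (1744 * (1 / 2 ^ 27)) := by linarith
      have h6 : (65536 * (1744 * (1 / 2 ^ 27)) : ℝ) < 1 := by norm_num
      nlinarith
    exact_mod_cast this
  obtain ⟨j, hj1, hj2, hj3⟩ := exists_center (c := c) (k := k) (ρ := 436 * ε) (by omega) (by omega)
    hquad ((sum_sq_sub_le (by omega) hkn hf hl hε).trans (by
      have : 2 + 872 * ε ≤ 4 := by linarith
      exact mul_le_mul_of_nonneg_left this (by positivity)))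
    (sum_sq_sub_round_le (by omega) hkn hf hl hε)
  set e : Fin n → ℤ := fun i => round (c i - c j) with he
  set δ : Fin n → ℝ := fun i => c i - c j - e i with hδ
  have hsub : ({i | e i ≠ 0} : Finset (Fin n)) ⊆ farSet c j := by
    intro i hi
    rw [mem_farSet]
    by_contra! hlt
    refine (mem_filter.mp hi).2 ?_
    rw [abs_lt] at hlt
    exact round_eq_zero_iff.mpr ⟨by linarith, by linarith⟩
  have hcard := card_le_card hsub
  have hvar := sqNorm_linear_sub_mean_le hk (by omega : k ≤ n) δ
  set p : ℝ := k / n with hp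
  have hδsum : p * ∑ i, δ i ^ 2 ≤ 13952 * ε := by
    rw [hp, div_mul_eq_mul_div, div_le_iff₀ hn0]
    calc k * ∑ i, δ i ^ 2 ≤ 32 * n * (436 * ε) := hj3
      _ = 13952 * ε * n := by ring
  -- The constant term after recentring: `∑ x_i = k` turns the common coefficient `c j` into `c j *
  -- k`, and the rounding errors are replaced by their mean.
  set s : ℝ := c₀ + c j * k + p * ∑ i, δ i with hs
  set b : ℤ := round s with hb
  refine ⟨b, e, by omega, ?_, ?_⟩
  · refine le_trans (mul_le_mul_of_nonneg_left ?_ hk0.le) hj2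
    exact_mod_cast hcard
  have hdecomp : ∀ x : Slice n k, l x = s + ∑ i, e i * coord i x
      + (∑ i, δ i * coord i x - p * ∑ i, δ i) := by
    intro x
    have h1 : ∑ i, c i * coord i x = ∑ i, c j * coord i x + ∑ i, e i * coord i x
        + ∑ i, δ i * coord i x := by
      rw [← sum_add_distrib, ← sum_add_distrib]
      exact sum_congr rfl fun i _ => by simp only [hδ]; ring
    have h2 : ∑ i, c j * coord i x = c j * k := by
      rw [sum_mul_coord, sum_const, x.2, nsmul_eq_mul, mul_comm]
    rw [hl, h1, h2, hs]; ring
  -- Since `f - ∑ e i * x_i` is an integer `m`, rounding `s` moves it by at most `|s - m|`, so the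
  -- error at most doubles. In expectation this gives `8 + 8 * 13952 = 111624`.
  have hpt : ∀ x, (f x - (b + ∑ i, e i * coord i x)) ^ 2 ≤
      8 * (f x - l x) ^ 2 + 8 * (∑ i, δ i * coord i x - p * ∑ i, δ i) ^ 2 := by
    intro x
    obtain ⟨m, hm⟩ : ∃ m : ℤ, (m : ℝ) = f x - ∑ i, e i * coord i x := by
      rw [sum_mul_coord]
      rcases hf x with h | h <;> rw [h]
      · exact ⟨0 - ∑ i ∈ x.1, e i, by push_cast; rfl⟩
      · exact ⟨1 - ∑ i ∈ x.1, e i, by push_cast; rfl⟩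
    have hround := sq_le_sq.mpr (round_le s m)
    rw [← hb, hm] at hround
    rw [hdecomp x]
    set Y := ∑ i, (e i : ℝ) * coord i x
    set Z := ∑ i, δ i * coord i x - p * ∑ i, δ i
    nlinarith [sq_nonneg ((f x - Y - s) + (s - b)), sq_nonneg ((f x - Y - s) - (s - b)),
      sq_nonneg ((f x - (s + Y + Z)) - Z)]
  have := expect_le_expect (s := univ) fun x _ => hpt x
  simp only [expect_add_distrib, ← mul_expect] at this
  have h1 : (𝔼 x, (f x - l x) ^ 2) ≤ ε := hε
  have h2 : (𝔼 x : Slice n k, (∑ i, δ i * coord i x - p * ∑ i, δ i) ^ 2) ≤ p * ∑ i, δ i ^ 2 := hvar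
  unfold sqNorm
  linarith

end Rounding

/-! ### Maxima of coordinates and Boolean errors -/

section MaxCoord

variable {n k : ℕ}

lemma maxCoord_eq_ite (S : Finset (Fin n)) (x : Slice n k) :
    maxCoord S x = if (x.1 ∩ S).Nonempty then 1 else 0 := by
  unfold maxCoord
  induction S using Finset.induction_on with
  | empty => simp
  | insert i S hi ih =>
    rw [fold_insert hi, ih]
    by_cases h1 : i ∈ x.1
    · rw [inter_insert_of_mem h1, if_pos (insert_nonempty _ _), coord, if_pos h1]
      split_ifs <;> norm_num
    · rw [inter_insert_of_notMem h1, coord, if_neg h1]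
      split_ifs <;> norm_num

lemma isBoolean_maxCoord (S : Finset (Fin n)) : IsBoolean (maxCoord (k := k) S) := by
  intro x
  rw [maxCoord_eq_ite]
  split_ifs <;> simp

lemma sq_sub_le_one {u v : ℝ} (hu : u = 0 ∨ u = 1) (hv : v = 0 ∨ v = 1) : (u - v) ^ 2 ≤ 1 := by
  rcases hu with rfl | rfl <;> rcases hv with rfl | rfl <;> norm_num

lemma one_le_sq_sub_intCast {u : ℝ} (hu : u = 0 ∨ u = 1) {m : ℤ} (h0 : m ≠ 0) (h1 : m ≠ 1) :
    1 ≤ (u - m) ^ 2 := by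
  have h : ∀ a : ℤ, a ≠ 0 → (1 : ℝ) ≤ (a : ℝ) ^ 2 := fun a ha => by
    have : (0 : ℤ) < a ^ 2 := by positivity
    exact_mod_cast this
  rcases hu with rfl | rfl
  · simpa using h m h0
  · have := h (1 - m) (sub_ne_zero.mpr (Ne.symm h1))
    push_cast at this
    exact this

end MaxCoord

/-! ### Probability of avoiding a small set -/

section Avoidance

/-- A lower bound for the probability that a point of the slice avoids a small set. -/
lemma exp_le_choose_div_choose {n k s : ℕ} (hkn : 2 * k ≤ n) (hs : 4 * s ≤ n) (hn : 0 < n) {L : ℝ}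
    (hks : (k : ℝ) * s ≤ L * n) :
    Real.exp (-(4 * L)) ≤ ((n - s).choose k : ℝ) / n.choose k := by
  have hn0 : (0 : ℝ) < n := by exact_mod_cast hn
  set u : ℝ := 2 * s / n with hu
  have hu0 : 0 ≤ u := by positivity
  have hu1 : u ≤ 1 / 2 := by
    rw [hu, div_le_iff₀ hn0]
    have : (4 * s : ℝ) ≤ n := by exact_mod_cast hs
    linarith
  -- As `m < k ≤ n / 2` in each factor, `(n - s - m) / (n - m) ≥ 1 - 2 * s / n = 1 - u`.
  have hdesc : ∀ m, m ≤ k → (1 - u) ^ m * n.descFactorial m ≤ (n - s).descFactorial m := by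
    intro m
    induction m with
    | zero => simp
    | succ m ih =>
      intro hm
      have ih' := ih (by omega)
      rw [Nat.descFactorial_succ, Nat.descFactorial_succ, pow_succ]
      push_cast [Nat.cast_sub (show m ≤ n by omega), Nat.cast_sub (show m ≤ n - s by omega),
        Nat.cast_sub (show s ≤ n by omega)]
      have hmn : (2 * m : ℝ) ≤ n := by exact_mod_cast (by omega : 2 * m ≤ n)
      have hstep : (1 - u) * ((n : ℝ) - m) ≤ n - s - m := by
        have : (s : ℝ) = u * n / 2 := by rw [hu]; field_simp
        rw [this]
        nlinarith
      have h0 : (0 : ℝ) ≤ (1 - u) ^ m * n.descFactorial m := by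
        have : 0 ≤ 1 - u := by linarith
        positivity
      have h1 : 0 ≤ (1 - u) * ((n : ℝ) - m) := mul_nonneg (by linarith) (by linarith)
      calc (1 - u) ^ m * (1 - u) * (((n : ℝ) - m) * n.descFactorial m)
          = ((1 - u) * ((n : ℝ) - m)) * ((1 - u) ^ m * n.descFactorial m) := by ring
        _ ≤ (n - s - m) * (n - s).descFactorial m := mul_le_mul hstep ih' h0 (h1.trans hstep)
  have hexp : Real.exp (-(2 * u)) ≤ 1 - u := by
    rw [Real.exp_neg, inv_le_comm₀ (Real.exp_pos _) (by linarith)]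
    refine le_trans ?_ (Real.add_one_le_exp (2 * u))
    rw [inv_le_iff_one_le_mul₀ (by linarith)]
    nlinarith
  have hchoose : (0 : ℝ) < n.choose k := by exact_mod_cast Nat.choose_pos (by omega)
  rw [le_div_iff₀ hchoose]
  have hk := hdesc k le_rfl
  rw [Nat.descFactorial_eq_factorial_mul_choose, Nat.descFactorial_eq_factorial_mul_choose] at hk
  push_cast at hk
  have hfac : (0 : ℝ) < k.factorial := by exact_mod_cast k.factorial_pos
  have hk' : (1 - u) ^ k * n.choose k ≤ (n - s).choose k := by
    refine le_of_mul_le_mul_left ?_ hfac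
    linarith
  refine le_trans (mul_le_mul_of_nonneg_right ?_ hchoose.le) hk'
  calc Real.exp (-(4 * L)) ≤ Real.exp (k * -(2 * u)) := by
        refine Real.exp_le_exp.mpr ?_
        have : (k : ℝ) * u ≤ 2 * L := by
          rw [hu, mul_div_assoc', div_le_iff₀ hn0]; linarith
        linarith
    _ = Real.exp (-(2 * u)) ^ k := Real.exp_nat_mul _ _
    _ ≤ (1 - u) ^ k := pow_le_pow_left₀ (Real.exp_pos _).le hexp k

/-- From `(k + 1) * N.choose (k + 1) = (N - k) * N.choose k`. Requiring one more prescribed element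
thus costs at most a factor of the density compared with avoiding the support. -/
lemma density_mul_choose_le {n N k : ℕ} (hN : N ≤ n) (hn : 0 < n) :
    ((k + 1 : ℕ) / n : ℝ) * N.choose (k + 1) ≤ N.choose k := by
  have hn0 : (0 : ℝ) < n := by exact_mod_cast hn
  rw [div_mul_eq_mul_div, div_le_iff₀ hn0]
  have h := Nat.choose_succ_right_eq N k
  have h2 : N.choose k * (N - k) ≤ N.choose k * n := Nat.mul_le_mul_left _ (by omega)
  have : (k + 1) * N.choose (k + 1) ≤ N.choose k * n := by linarith
  exact_mod_cast this

end Avoidance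

/-! ### From integral affine functions to maxima -/

section IntegralAffine

variable {n k : ℕ} {f : Slice n k → ℝ} {e : Fin n → ℤ} {κ : ℝ}

lemma sum_intCast_mul_coord (e : Fin n → ℤ) {S : Finset (Fin n)} (hS : ∀ i, i ∉ S → e i = 0)
    (x : Slice n k) : ∑ i, (e i : ℝ) * coord i x = ((∑ i ∈ x.1 ∩ S, e i : ℤ) : ℝ) := by
  rw [sum_mul_coord, Int.cast_sum]
  symm
  refine sum_subset inter_subset_left fun i hi hi' => ?_
  rw [hS i fun h => hi' (mem_inter.mpr ⟨hi, h⟩), Int.cast_zero]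

/-- If `f - h` is large whenever the trace on `S` is in a family of `r`-sets, the family is small. -/
lemma card_mul_le_sqNorm {h : Slice n k → ℝ} {S : Finset (Fin n)} {P : Finset (Finset (Fin n))}
    {r : ℕ} (hr : r ≤ k) (hP : ∀ T ∈ P, T ⊆ S ∧ #T = r)
    (hbig : ∀ x : Slice n k, x.1 ∩ S ∈ P → 1 ≤ h x ^ 2) :
    #P * (((n - #S).choose (k - r) : ℝ) / n.choose k) ≤ sqNorm h := by
  have hpt : ∀ x : Slice n k, ∑ T ∈ P, (if x.1 ∩ S = T then (1 : ℝ) else 0) ≤ h x ^ 2 := by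
    intro x
    rw [sum_ite_eq]
    split_ifs with hx
    · exact hbig x hx
    · exact sq_nonneg _
  refine le_trans (le_of_eq ?_) (expect_le_expect (s := univ) fun x _ => hpt x)
  rw [expect_sum_comm, ← nsmul_eq_mul, ← sum_const]
  refine sum_congr rfl fun T hT => ?_
  obtain ⟨h1, h2⟩ := hP T hT
  rw [expect_inter_eq h1 (by omega), h2]

/-- The coefficients equal to `1`. -/
def unitSet (e : Fin n → ℤ) : Finset (Fin n) := {i | e i = 1}

/-- The coefficients different from `0, 1`. -/
def badSet (e : Fin n → ℤ) : Finset (Fin n) := {i | e i ≠ 0 ∧ e i ≠ 1}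

/-- The nonzero coefficients. -/
def suppSet (e : Fin n → ℤ) : Finset (Fin n) := {i | e i ≠ 0}

lemma unitSet_subset_suppSet (e : Fin n → ℤ) : unitSet e ⊆ suppSet e := by
  intro i hi
  simp only [unitSet, suppSet, mem_filter, mem_univ, true_and] at hi ⊢
  omega

lemma badSet_subset_suppSet (e : Fin n → ℤ) : badSet e ⊆ suppSet e := by
  intro i hi
  simp only [badSet, suppSet, mem_filter, mem_univ, true_and] at hi ⊢
  exact hi.1

lemma eq_zero_of_notMem_suppSet {i : Fin n} (h : i ∉ suppSet e) : e i = 0 := by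
  simpa [suppSet] using h

lemma eq_one_of_mem_unitSet {i : Fin n} (h : i ∈ unitSet e) : e i = 1 := by
  simpa [unitSet] using h

/-- A point meeting the support in a single bad index has error at least 1, and each such trace has
probability at least `k / n * κ`. -/
lemma card_badSet_le (hf : IsBoolean f) (hk : 2 ≤ k) (hn : 0 < n)
    (hκ : κ ≤ ((n - #(suppSet e)).choose k : ℝ) / n.choose k) :
    #(badSet e) * (k / n * κ) ≤ sqNorm fun x => f x - ∑ i, e i * coord i x := by
  have h := card_mul_le_sqNorm (h := fun x => f x - ∑ i, e i * coord i x) (S := suppSet e)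
    (P := powersetCard 1 (badSet e)) (r := 1) (by omega)
    (fun T hT => ⟨(mem_powersetCard.mp hT).1.trans (badSet_subset_suppSet e),
      (mem_powersetCard.mp hT).2⟩) (by
      intro x hx
      obtain ⟨h1, h2⟩ := mem_powersetCard.mp hx
      obtain ⟨i, hi⟩ := card_eq_one.mp h2
      have hib : i ∈ badSet e := h1 (by rw [hi]; simp)
      simp only [badSet, mem_filter, mem_univ, true_and] at hib
      rw [sum_intCast_mul_coord e (fun i => eq_zero_of_notMem_suppSet) x, hi, sum_singleton]
      exact one_le_sq_sub_intCast (hf x) hib.1 hib.2)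
  rw [card_powersetCard, Nat.choose_one_right] at h
  refine le_trans (mul_le_mul_of_nonneg_left ?_ (Nat.cast_nonneg _)) h
  refine (mul_le_mul_of_nonneg_left hκ (by positivity)).trans ?_
  rw [mul_div_assoc']
  refine div_le_div_of_nonneg_right ?_ (Nat.cast_nonneg _)
  obtain ⟨m, rfl⟩ := Nat.exists_eq_add_of_le' hk
  exact density_mul_choose_le (k := m + 1) (Nat.sub_le _ _) hn

/-- A point meeting the support in exactly two unit indices gets the value 2, hence error at least
1. -/
lemma choose_card_unitSet_le (hf : IsBoolean f) (hk : 2 ≤ k) (hn : 0 < n)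
    (hκ : κ ≤ ((n - #(suppSet e)).choose k : ℝ) / n.choose k) :
    (#(unitSet e)).choose 2 * ((k / n) ^ 2 / 2 * κ) ≤
      sqNorm fun x => f x - ∑ i, e i * coord i x := by
  have h := card_mul_le_sqNorm (h := fun x => f x - ∑ i, e i * coord i x) (S := suppSet e)
    (P := powersetCard 2 (unitSet e)) (r := 2) hk
    (fun T hT => ⟨(mem_powersetCard.mp hT).1.trans (unitSet_subset_suppSet e),
      (mem_powersetCard.mp hT).2⟩) (by
      intro x hx
      obtain ⟨h1, h2⟩ := mem_powersetCard.mp hx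
      have hsum : ∑ i ∈ x.1 ∩ suppSet e, e i = 2 := by
        rw [sum_congr rfl fun i hi => eq_one_of_mem_unitSet (h1 hi)]
        simp [h2]
      rw [sum_intCast_mul_coord e (fun i => eq_zero_of_notMem_suppSet) x, hsum]
      exact one_le_sq_sub_intCast (hf x) (by norm_num) (by norm_num))
  rw [card_powersetCard] at h
  refine le_trans (mul_le_mul_of_nonneg_left ?_ (Nat.cast_nonneg _)) h
  refine (mul_le_mul_of_nonneg_left hκ (by positivity)).trans ?_
  rw [mul_div_assoc']
  refine div_le_div_of_nonneg_right ?_ (Nat.cast_nonneg _)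
  obtain ⟨m, rfl⟩ := Nat.exists_eq_add_of_le' hk
  have h1 := density_mul_choose_le (n := n) (k := m + 1) (Nat.sub_le n (#(suppSet e))) hn
  have h2 := density_mul_choose_le (n := n) (k := m) (Nat.sub_le n (#(suppSet e))) hn
  set N := n - #(suppSet e)
  rw [Nat.add_sub_cancel]
  -- The second prescribed element costs `(k - 1) / n`, at least half of `k / n` because `k ≥ 2`.
  have hhalf : ((m + 2 : ℕ) / n : ℝ) / 2 ≤ ((m + 1 : ℕ) / n : ℝ) := by
    rw [div_right_comm]
    refine div_le_div_of_nonneg_right ?_ (Nat.cast_nonneg _)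
    push_cast
    have : (0 : ℝ) ≤ m := Nat.cast_nonneg m
    linarith
  calc ((m + 2 : ℕ) / n : ℝ) ^ 2 / 2 * N.choose (m + 2)
      = ((m + 2 : ℕ) / n : ℝ) / 2 * (((m + 2 : ℕ) / n : ℝ) * N.choose (m + 2)) := by ring
    _ ≤ ((m + 1 : ℕ) / n : ℝ) * N.choose (m + 1) :=
        mul_le_mul hhalf h1 (by positivity) (by positivity)
    _ ≤ N.choose m := h2

/-- The linear function equals the maximum unless the point contains a bad index or two unit
indices; a union bound covers these events. -/
lemma sqNorm_sub_maxCoord_unitSet_le (hf : IsBoolean f) (hk : 2 ≤ k) (hkn : k ≤ n) :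
    sqNorm (fun x => f x - maxCoord (unitSet e) x) ≤
      sqNorm (fun x => f x - ∑ i, e i * coord i x) + #(badSet e) * (k / n)
        + (#(unitSet e)).choose 2 * (k / n) ^ 2 := by
  have hpt : ∀ x : Slice n k, (f x - maxCoord (unitSet e) x) ^ 2 ≤
      (f x - ∑ i, e i * coord i x) ^ 2 + ∑ i ∈ badSet e, coord i x
        + ∑ T ∈ powersetCard 2 (unitSet e), ∏ i ∈ T, coord i x := by
    intro x
    have hc : ∀ i, 0 ≤ coord i x := fun i => by unfold coord; split_ifs <;> norm_num
    have hs1 : 0 ≤ ∑ i ∈ badSet e, coord i x := sum_nonneg fun i _ => hc i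
    have hs2 : 0 ≤ ∑ T ∈ powersetCard 2 (unitSet e), ∏ i ∈ T, coord i x :=
      sum_nonneg fun T _ => prod_nonneg fun i _ => hc i
    have hle1 := sq_sub_le_one (hf x) (isBoolean_maxCoord (unitSet e) x)
    have hsq := sq_nonneg (f x - ∑ i, e i * coord i x)
    by_cases hbad : ∃ i ∈ badSet e, i ∈ x.1
    · obtain ⟨i, hi, hix⟩ := hbad
      have := single_le_sum (f := fun i => coord i x) (fun i _ => hc i) hi
      simp only [coord, if_pos hix] at this
      simp only [coord] at hs2 hsq ⊢
      linarith
    push Not at hbad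
    rcases lt_or_ge 1 #(x.1 ∩ unitSet e) with hbig | hsmall
    · obtain ⟨T, hT, hTc⟩ := exists_subset_card_eq hbig
      have hTm : T ∈ powersetCard 2 (unitSet e) :=
        mem_powersetCard.mpr ⟨hT.trans inter_subset_right, hTc⟩
      have := single_le_sum (f := fun T => ∏ i ∈ T, coord i x)
        (fun T _ => prod_nonneg fun i _ => hc i) hTm
      have h1 : ∏ i ∈ T, coord i x = 1 := prod_eq_one fun i hi => by
        rw [coord, if_pos (mem_inter.mp (hT hi)).1]
      rw [h1] at this
      linarith
    · have hg : ∑ i, (e i : ℝ) * coord i x = maxCoord (unitSet e) x := by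
        rw [sum_intCast_mul_coord e (S := suppSet e) (fun i => eq_zero_of_notMem_suppSet) x,
          maxCoord_eq_ite]
        have heq : x.1 ∩ suppSet e = x.1 ∩ unitSet e := by
          ext i
          have := hbad i
          simp only [badSet, suppSet, unitSet, mem_inter, mem_filter, mem_univ, true_and] at this ⊢
          constructor
          · rintro ⟨h1, h2⟩
            exact ⟨h1, by by_contra h3; exact this ⟨h2, h3⟩ h1⟩
          · rintro ⟨h1, h2⟩
            exact ⟨h1, by omega⟩
        rw [heq, sum_congr rfl fun i hi => eq_one_of_mem_unitSet (mem_inter.mp hi).2]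
        rcases (x.1 ∩ unitSet e).eq_empty_or_nonempty with h0 | h0
        · simp [h0]
        · have : #(x.1 ∩ unitSet e) = 1 := le_antisymm hsmall (card_pos.mpr h0)
          rw [if_pos h0, sum_const, this]
          norm_num
      rw [hg] at hsq ⊢
      linarith
  refine (expect_le_expect (s := univ) fun x _ => hpt x).trans ?_
  rw [expect_add_distrib, expect_add_distrib, expect_sum_comm, expect_sum_comm]
  refine add_le_add (add_le_add le_rfl (le_of_eq ?_)) ?_
  · rw [← nsmul_eq_mul, ← sum_const]
    exact sum_congr rfl fun i _ => expect_coord (by omega) hkn i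
  · rw [← card_powersetCard, ← nsmul_eq_mul]
    refine sum_le_card_nsmul _ _ _ fun T hT => ?_
    obtain ⟨i, j, hij, rfl⟩ := card_eq_two.mp (mem_powersetCard.mp hT).2
    simp only [prod_pair hij]
    rw [expect_coord_mul_coord hk hkn hij]
    exact pair_density_le (by omega) hkn (by omega)

/-- A Boolean function close to an integral linear function with small support is close to a
maximum of coordinates. -/
lemma close_maxCoord_of_close_integral (hf : IsBoolean f) (hk : 2 ≤ k) (hkn : k ≤ n) (hκ0 : 0 < κ)
    (hκ1 : κ ≤ 1) (hκ : κ ≤ ((n - #(suppSet e)).choose k : ℝ) / n.choose k) {η : ℝ}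
    (hη : sqNorm (fun x => f x - ∑ i, e i * coord i x) ≤ η) :
    sqNorm (fun x => f x - maxCoord (unitSet e) x) ≤ 4 / κ * η ∧
      (#(unitSet e) ≤ 1 ∨ (#(unitSet e) * (k / n : ℝ)) ^ 2 ≤ 8 / κ * η) := by
  have hn : 0 < n := by omega
  have hbad := (card_badSet_le hf hk hn hκ).trans hη
  have hunit := (choose_card_unitSet_le hf hk hn hκ).trans hη
  have hmax := sqNorm_sub_maxCoord_unitSet_le (e := e) hf hk hkn
  set p : ℝ := k / n
  have hη0 : 0 ≤ η := le_trans (expect_nonneg fun x _ => sq_nonneg _) hη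
  have h1 : #(badSet e) * p ≤ η / κ := by rw [le_div_iff₀ hκ0]; linarith
  have h2 : (#(unitSet e)).choose 2 * p ^ 2 ≤ 2 * (η / κ) := by
    rw [mul_div_assoc', le_div_iff₀ hκ0]; linarith
  have h3 : η ≤ η / κ := by rw [le_div_iff₀ hκ0]; nlinarith
  refine ⟨?_, ?_⟩
  · have : 4 / κ * η = 4 * (η / κ) := by ring
    rw [this]; linarith
  · rcases le_or_gt #(unitSet e) 1 with h | h
    · exact Or.inl h
    · right
      rw [Nat.cast_choose_two] at h2
      have h4 : (2 : ℝ) ≤ #(unitSet e) := by exact_mod_cast h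
      have : 8 / κ * η = 8 * (η / κ) := by ring
      rw [this]
      set g : ℝ := (#(unitSet e) : ℝ)
      -- For `g ≥ 2` this yields `g * (g - 1) / 2 ≥ g ^ 2 / 4`.
      have : 0 ≤ g * (g - 2) * p ^ 2 := mul_nonneg (by nlinarith) (sq_nonneg _)
      nlinarith

end IntegralAffine

/-- The lower bound for the probability of avoiding the support of the rounded coefficients. -/
noncomputable def avoidConst : ℝ := Real.exp (-(4 * 512))

/-- The loss in the approximation error. -/
noncomputable def errorConst : ℝ := 2 ^ 27 * (4 / avoidConst * 111624)

/-- The constant in the bound on the number of coordinates. -/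
noncomputable def cardConst : ℝ := Real.sqrt (8 / avoidConst * 111624)

lemma avoidConst_pos : 0 < avoidConst := Real.exp_pos _

lemma avoidConst_le_one : avoidConst ≤ 1 := Real.exp_le_one_iff.mpr (by norm_num)

lemma errorConst_pos : 0 < errorConst := by
  have := avoidConst_pos
  unfold errorConst
  positivity

lemma cardConst_pos : 0 < cardConst := by
  have := avoidConst_pos
  exact Real.sqrt_pos.mpr (by positivity)

/-! ### The theorem for `k ≤ n / 2` -/

section LowerHalf

variable {n k : ℕ} {f l : Slice n k → ℝ} {ε : ℝ}

lemma sqNorm_nonneg {D : Type} [Fintype D] (h : D → ℝ) : 0 ≤ sqNorm h :=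
  expect_nonneg fun _ _ => sq_nonneg _

lemma card_le_of_sq_le {g : ℕ} {p : ℝ} (hp : 0 < p) (hε : 0 ≤ ε)
    (h : g ≤ 1 ∨ (g * p) ^ 2 ≤ 8 / avoidConst * (111624 * ε)) :
    (g : ℝ) ≤ max 1 (cardConst * (Real.sqrt ε / p)) := by
  rcases h with h | h
  · exact le_max_of_le_left (by exact_mod_cast h)
  · refine le_max_of_le_right ?_
    rw [mul_div_assoc', le_div_iff₀ hp, cardConst, ← Real.sqrt_mul' _ hε]
    refine Real.le_sqrt_of_sq_le (h.trans (le_of_eq ?_))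
    ring

/-- The theorem for `k ≤ n / 2`. -/
theorem slice_fkn_of_two_mul_le (hk : 2 ≤ k) (hkn : 2 * k ≤ n) (hf : IsBoolean f)
    (hl : IsAffine l) (hε : IsClose ε f l) :
    ∃ S : Finset (Fin n), (#S : ℝ) ≤ max 1 (cardConst * (Real.sqrt ε / (k / n))) ∧
      (IsClose (errorConst * ε) f (maxCoord S) ∨
        IsClose (errorConst * ε) (fun x => 1 - f x) (maxCoord S)) := by
  have hε0 : 0 ≤ ε := (sqNorm_nonneg _).trans hε
  have := slice_nonempty (show k ≤ n by omega)
  have hκ0 := avoidConst_pos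
  have hκ1 := avoidConst_le_one
  by_cases hbig : 1 ≤ errorConst * ε
  -- Boolean functions are always 1-close, so any set works when the allowed error is at least 1.
  · refine ⟨∅, by simp, Or.inl (le_trans ?_ hbig)⟩
    refine (expect_le_expect fun x _ =>
      sq_sub_le_one (hf x) (isBoolean_maxCoord ∅ x)).trans (le_of_eq ?_)
    exact Fintype.expect_const _
  push Not at hbig
  have hE : 4 / avoidConst * (111624 * ε) ≤ errorConst * ε := by
    have : 0 ≤ 4 / avoidConst * (111624 * ε) := by positivity
    unfold errorConst
    linarith
  -- The factor `2 ^ 27` in `errorConst` serves to give both `ε ≤ 1 / 2 ^ 27` and an integral error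
  -- below `avoidConst`.
  have hsmall' : 2 ^ 27 * (4 * (111624 * ε)) < avoidConst := by
    have h : errorConst * ε = 2 ^ 27 * (4 * (111624 * ε)) / avoidConst := by
      unfold errorConst; ring
    rwa [h, div_lt_one hκ0] at hbig
  have hsmall : ε ≤ 1 / 2 ^ 27 := by linarith
  obtain ⟨c₀, c, hl⟩ := hl
  obtain ⟨b, e, he1, he2, he3⟩ := exists_integral_affine hk hkn hf hl hε hsmall
  have hp : (0 : ℝ) < k / n :=
    div_pos (by exact_mod_cast (by omega : 0 < k)) (by exact_mod_cast (by omega : 0 < n))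
  have hκ : avoidConst ≤ ((n - #(suppSet e)).choose k : ℝ) / n.choose k :=
    exp_le_choose_div_choose hkn he1 (by omega) he2
  -- Points avoiding the support have value `b` and probability at least `avoidConst`; any other `b`
  -- would cost more than the error available.
  have hb : b = 0 ∨ b = 1 := by
    by_contra! hb
    have h := card_mul_le_sqNorm (h := fun x => f x - (b + ∑ i, e i * coord i x))
      (S := suppSet e) (P := {∅}) (r := 0) (by omega) (by simp) (by
        intro x hx
        rw [mem_singleton] at hx
        rw [sum_intCast_mul_coord e (fun i => eq_zero_of_notMem_suppSet) x, hx, sum_empty,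
          Int.cast_zero, add_zero]
        exact one_le_sq_sub_intCast (hf x) hb.1 hb.2)
    rw [card_singleton, Nat.cast_one, one_mul, Nat.sub_zero] at h
    linarith
  rcases hb with rfl | rfl
  · simp only [Int.cast_zero, zero_add] at he3
    obtain ⟨h1, h2⟩ := close_maxCoord_of_close_integral hf hk (by omega) hκ0 hκ1 hκ he3
    exact ⟨unitSet e, card_le_of_sq_le hp hε0 h2, Or.inl (h1.trans hE)⟩
  · have hf' : IsBoolean fun x => 1 - f x := fun x => by
      rcases hf x with h | h <;> simp [h]
    have hsupp : suppSet (fun i => - e i) = suppSet e := by simp [suppSet]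
    have he3' : sqNorm (fun x => 1 - f x - ∑ i, ((- e i : ℤ) : ℝ) * coord i x) ≤ 111624 * ε := by
      refine le_trans (le_of_eq ?_) he3
      refine expect_congr rfl fun x _ => ?_
      simp only [Int.cast_neg, neg_mul, sum_neg_distrib, Int.cast_one]
      ring
    obtain ⟨h1, h2⟩ := close_maxCoord_of_close_integral (e := fun i => - e i) hf' hk (by omega)
      hκ0 hκ1 (by rw [hsupp]; exact hκ) he3'
    exact ⟨unitSet fun i => - e i, card_le_of_sq_le hp hε0 h2, Or.inr (h1.trans hE)⟩

end LowerHalf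

/-! ### Complementation: the case `k ≥ n / 2` -/

section Duality

variable {n k : ℕ}

/-- Complementation as a bijection between complementary slices. -/
def complSlice (h : k ≤ n) : Slice n (n - k) ≃ Slice n k where
  toFun x := ⟨x.1ᶜ, by rw [card_compl, Fintype.card_fin, x.2]; omega⟩
  invFun x := ⟨x.1ᶜ, by rw [card_compl, Fintype.card_fin, x.2]⟩
  left_inv x := Subtype.ext (compl_compl x.1)
  right_inv x := Subtype.ext (compl_compl x.1)

lemma sqNorm_comp_equiv {D D' : Type} [Fintype D] [Fintype D'] (φ : D ≃ D') (h : D' → ℝ) :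
    sqNorm (fun x => h (φ x)) = sqNorm h :=
  Fintype.expect_equiv φ _ _ fun _ => rfl

lemma coord_complSlice (h : k ≤ n) (i : Fin n) (x : Slice n (n - k)) :
    coord i (complSlice h x) = 1 - coord i x := by
  by_cases hi : i ∈ x.1 <;> simp [coord, complSlice, hi]

lemma minCoord_complSlice (h : k ≤ n) (S : Finset (Fin n)) (x : Slice n (n - k)) :
    minCoord S (complSlice h x) = 1 - maxCoord S x := by
  unfold minCoord maxCoord
  induction S using Finset.induction_on with
  | empty => simp
  | insert i S hi ih =>
    rw [fold_insert hi, fold_insert hi, ih, coord_complSlice, min_sub_sub_left]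

lemma isClose_one_sub {D : Type} [Fintype D] {ε : ℝ} {f g : D → ℝ} :
    IsClose ε (fun x => 1 - f x) g ↔ IsClose ε f fun x => 1 - g x := by
  unfold IsClose sqNorm
  have : ∀ x, (1 - f x - g x) ^ 2 = (f x - (1 - g x)) ^ 2 := fun x => by ring
  simp only [this]

/-- The theorem for `k ≥ n / 2`. -/
theorem slice_fkn_of_le_two_mul (hk : k + 2 ≤ n) (hkn : n ≤ 2 * k) {f l : Slice n k → ℝ}
    (hf : IsBoolean f) (hl : IsAffine l) {ε : ℝ} (hε : IsClose ε f l) :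
    ∃ S : Finset (Fin n), (#S : ℝ) ≤ max 1 (cardConst * (Real.sqrt ε / (1 - k / n))) ∧
      (IsClose (errorConst * ε) f (minCoord S) ∨
        IsClose (errorConst * ε) (fun x => 1 - f x) (minCoord S)) := by
  have hle : k ≤ n := by omega
  have hn0 : (n : ℝ) ≠ 0 := by exact_mod_cast (by omega : n ≠ 0)
  set φ := complSlice hle with hφ
  have hclose : ∀ {δ : ℝ} {g h : Slice n k → ℝ},
      IsClose δ (fun x => g (φ x)) (fun x => h (φ x)) ↔ IsClose δ g h := by
    intro δ g h
    unfold IsClose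
    rw [sqNorm_comp_equiv φ fun x => g x - h x]
  have hl' : IsAffine fun x => l (φ x) := by
    obtain ⟨c₀, c, hl⟩ := hl
    refine ⟨c₀ + ∑ i, c i, fun i => - c i, fun x => ?_⟩
    simp only [hl, hφ, coord_complSlice]
    rw [add_assoc, ← sum_add_distrib]
    congr 1
    exact sum_congr rfl fun i _ => by ring
  obtain ⟨S, hS, h⟩ := slice_fkn_of_two_mul_le (k := n - k) (by omega) (by omega)
    (fun x => hf (φ x)) hl' (hclose.mpr hε)
  have hdens : ((n - k : ℕ) : ℝ) / n = 1 - k / n := by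
    rw [Nat.cast_sub hle, sub_div, div_self hn0]
  have hmax : maxCoord (k := n - k) S = fun x => 1 - minCoord S (φ x) := by
    funext x
    rw [hφ, minCoord_complSlice, sub_sub_cancel]
  rw [hdens] at hS
  refine ⟨S, hS, ?_⟩
  rw [hmax] at h
  -- Complementation turns the maximum into one minus the minimum, so the roles of `f` and `1 - f`
  -- are exchanged.
  rcases h with h | h
  · right
    rw [isClose_one_sub]
    exact hclose.mp h
  · left
    rw [isClose_one_sub] at h
    simp only [sub_sub_cancel] at h
    exact hclose.mp h

end Duality

/-! ### The density and sets of at most one element -/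

section Density

variable {n k : ℕ}

lemma density_of_two_mul_le (hn : 0 < n) (h : 2 * k ≤ n) : density n k = k / n := by
  have hn0 : (0 : ℝ) < n := by exact_mod_cast hn
  have h' : (2 * k : ℝ) ≤ n := by exact_mod_cast h
  refine min_eq_left ?_
  have : (k : ℝ) / n ≤ 1 / 2 := by rw [div_le_iff₀ hn0]; linarith
  linarith

lemma density_of_le_two_mul (hn : 0 < n) (h : n ≤ 2 * k) : density n k = 1 - k / n := by
  have hn0 : (0 : ℝ) < n := by exact_mod_cast hn
  have h' : (n : ℝ) ≤ 2 * k := by exact_mod_cast h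
  refine min_eq_right ?_
  have : 1 / 2 ≤ (k : ℝ) / n := by rw [le_div_iff₀ hn0]; linarith
  linarith

lemma density_pos (hk : 0 < k) (hkn : k < n) : 0 < density n k := by
  have hk0 : (0 : ℝ) < k := by exact_mod_cast hk
  have hkn' : (k : ℝ) < n := by exact_mod_cast hkn
  have hn0 : (0 : ℝ) < n := hk0.trans hkn'
  exact lt_min (div_pos hk0 hn0) (sub_pos.mpr ((div_lt_one hn0).mpr hkn'))

/-- The choice `c = 1 / C₂ ^ 2` makes the second term of the maximum at most 1, which leaves only
constants and single coordinates in the last assertion. -/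
lemma card_le_one_of_le_max {g : ℕ} {ε p : ℝ} (hp : 0 < p)
    (hε : ε ≤ 1 / cardConst ^ 2 * p ^ 2)
    (h : (g : ℝ) ≤ max 1 (cardConst * (Real.sqrt ε / p))) : g ≤ 1 := by
  have hC := cardConst_pos
  have hsqrt : Real.sqrt ε ≤ p / cardConst := by
    refine Real.sqrt_le_iff.mpr ⟨by positivity, hε.trans (le_of_eq ?_)⟩
    rw [div_pow]; ring
  have : cardConst * (Real.sqrt ε / p) ≤ 1 := by
    rw [mul_div_assoc', div_le_one hp, mul_comm]
    exact (le_div_iff₀ hC).mp hsqrt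
  rw [max_eq_left this] at h
  exact_mod_cast h

lemma coord_mem_zero_one (i : Fin n) (x : Slice n k) : 0 ≤ coord i x ∧ coord i x ≤ 1 := by
  unfold coord; split_ifs <;> norm_num

lemma maxCoord_empty : maxCoord (n := n) (k := k) ∅ = fun _ => 0 := by
  funext x; simp [maxCoord]

lemma minCoord_empty : minCoord (n := n) (k := k) ∅ = fun _ => 1 := by
  funext x; simp [minCoord]

lemma maxCoord_singleton (i : Fin n) : maxCoord (n := n) (k := k) {i} = coord i := by
  funext x; simp [maxCoord, (coord_mem_zero_one i x).1]

lemma minCoord_singleton (i : Fin n) : minCoord (n := n) (k := k) {i} = coord i := by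
  funext x; simp [minCoord, (coord_mem_zero_one i x).2]

end Density

end SliceFKN

theorem mainTheorem1 :
    ∃ C₁ C₂ c : ℝ, 0 < C₁ ∧ 0 < C₂ ∧ 0 < c ∧
      ∀ (n k : ℕ), 2 ≤ k → k + 2 ≤ n →
      ∀ (f : SliceFKN.Slice n k → ℝ), SliceFKN.IsBoolean f →
      ∀ (ε : ℝ), (∃ l : SliceFKN.Slice n k → ℝ, SliceFKN.IsAffine l ∧ SliceFKN.IsClose ε f l) →
        (2 * k ≤ n →
          ∃ S : Finset (Fin n),
            (S.card : ℝ) ≤ max 1 (C₂ * (Real.sqrt ε / SliceFKN.density n k)) ∧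
            (SliceFKN.IsClose (C₁ * ε) f (SliceFKN.maxCoord S) ∨
              SliceFKN.IsClose (C₁ * ε) (fun x => 1 - f x) (SliceFKN.maxCoord S))) ∧
        (n ≤ 2 * k →
          ∃ S : Finset (Fin n),
            (S.card : ℝ) ≤ max 1 (C₂ * (Real.sqrt ε / SliceFKN.density n k)) ∧
            (SliceFKN.IsClose (C₁ * ε) f (SliceFKN.minCoord S) ∨
              SliceFKN.IsClose (C₁ * ε) (fun x => 1 - f x) (SliceFKN.minCoord S))) ∧
        (ε ≤ c * SliceFKN.density n k ^ 2 →
          SliceFKN.IsClose (C₁ * ε) f (fun _ => 0) ∨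
          SliceFKN.IsClose (C₁ * ε) f (fun _ => 1) ∨
          ∃ i : Fin n,
            SliceFKN.IsClose (C₁ * ε) f (SliceFKN.coord i) ∨
            SliceFKN.IsClose (C₁ * ε) f (fun x => 1 - SliceFKN.coord i x)) := by
  have hC := SliceFKN.cardConst_pos
  refine ⟨SliceFKN.errorConst, SliceFKN.cardConst, 1 / SliceFKN.cardConst ^ 2,
    SliceFKN.errorConst_pos, hC, by positivity, ?_⟩
  rintro n k hk hkn f hf ε ⟨l, hl, hε⟩
  have lower : 2 * k ≤ n → ∃ S : Finset (Fin n),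
      (S.card : ℝ) ≤ max 1 (SliceFKN.cardConst * (Real.sqrt ε / SliceFKN.density n k)) ∧
      (SliceFKN.IsClose (SliceFKN.errorConst * ε) f (SliceFKN.maxCoord S) ∨
        SliceFKN.IsClose (SliceFKN.errorConst * ε) (fun x => 1 - f x) (SliceFKN.maxCoord S)) := by
    intro h
    rw [SliceFKN.density_of_two_mul_le (by omega) h]
    exact SliceFKN.slice_fkn_of_two_mul_le hk h hf hl hε
  have upper : n ≤ 2 * k → ∃ S : Finset (Fin n),
      (S.card : ℝ) ≤ max 1 (SliceFKN.cardConst * (Real.sqrt ε / SliceFKN.density n k)) ∧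
      (SliceFKN.IsClose (SliceFKN.errorConst * ε) f (SliceFKN.minCoord S) ∨
        SliceFKN.IsClose (SliceFKN.errorConst * ε) (fun x => 1 - f x) (SliceFKN.minCoord S)) := by
    intro h
    rw [SliceFKN.density_of_le_two_mul (by omega) h]
    exact SliceFKN.slice_fkn_of_le_two_mul hkn h hf hl hε
  refine ⟨lower, upper, fun hsmall => ?_⟩
  have hp : 0 < SliceFKN.density n k := SliceFKN.density_pos (by omega) (by omega)
  have : Nonempty (Fin n) := ⟨⟨0, by omega⟩⟩
  rcases le_total (2 * k) n with h | h
  · obtain ⟨S, hS, hclose⟩ := lower h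
    have hcard := SliceFKN.card_le_one_of_le_max hp hsmall hS
    simp only [SliceFKN.isClose_one_sub] at hclose
    rcases Nat.le_one_iff_eq_zero_or_eq_one.mp hcard with h0 | h1
    · rw [Finset.card_eq_zero.mp h0, SliceFKN.maxCoord_empty] at hclose
      simp only [sub_zero] at hclose
      tauto
    · obtain ⟨i, rfl⟩ := Finset.card_eq_one.mp h1
      rw [SliceFKN.maxCoord_singleton] at hclose
      exact Or.inr (Or.inr ⟨i, hclose⟩)
  · obtain ⟨S, hS, hclose⟩ := upper h
    have hcard := SliceFKN.card_le_one_of_le_max hp hsmall hS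
    simp only [SliceFKN.isClose_one_sub] at hclose
    rcases Nat.le_one_iff_eq_zero_or_eq_one.mp hcard with h0 | h1
    · rw [Finset.card_eq_zero.mp h0, SliceFKN.minCoord_empty] at hclose
      simp only [sub_self] at hclose
      tauto
    · obtain ⟨i, rfl⟩ := Finset.card_eq_one.mp h1
      rw [SliceFKN.minCoord_singleton] at hclose
      exact Or.inr (Or.inr ⟨i, hclose⟩)
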